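/- Let $d \ge 2$. For a measurable, locally bounded function $m$ on $\Gamma_3 = \{(z_1,z_2,z_3) \in (\mathbf{R}^d\times\mathbf{R})^3 : z_1+z_2+z_3=0\}$, let $\|m\|_{[3;\mathbf{R}^d\times\mathbf{R}]} \in [0,\infty]$ be the best constant in $$\Big|\int_{\Gamma_3} m(z)\, f_1(z_1) f_2(z_2) f_3(z_3)\Big| \le \|m\|_{[3;\mathbf{R}^d\times\mathbf{R}]} \prod_{j=1}^3 \|f_j\|_{L^2(\mathbf{R}^d\times\mathbf{R})}$$ for all test functions $f_1,f_2,f_3$, where the integral over $\Gamma_3$ is taken with respect to $dz_1\,dz_2$ with $z_3=-z_1-z_2$. Write $z_j = (\xi_j,\tau_j)$, let $(\epsilon_1,\epsilon_2,\epsilon_3) = (+1,+1,-1)$, and put $$\lambda_j := \tau_j - \epsilon_j|\xi_j|, \qquad h(\xi) := |\xi_1|+|\xi_2|-|\xi_3|.$$ For $N_1,N_2,N_3,L_1,L_2,L_3,H>0$ let $X = X_{N_1,N_2,N_3;H;L_1,L_2,L_3;\epsilon_1,\epsilon_2,\epsilon_3}$ be the indicator function of the set of points of $\Gamma_3$ where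 $|h(\xi)| \sim H$ and, for $j=1,2,3$, $|\xi_j|\sim N_j$, $\epsilon_j\tau_j \ge 0$, $|\lambda_j| \sim L_j$. Write $N_{max}\ge N_{med}\ge N_{min}$ for the maximum, median and minimum of $N_1,N_2,N_3$, and similarly for the $L_j$. Assume that $$N_{max}\sim N_{med}, \qquad L_{max} \sim \max(H,L_{med}), \qquad H\lesssim \min(N_1,N_2).$$ 1. ($(++)$ high-high interactions) If $N_1\sim N_2\gg N_3$, then $$\|X\|_{[3;\mathbf{R}^d\times\mathbf{R}]} \lesssim L_{min}^{1/2}\min(L_{med},N_3)^{1/2} N_3^{(d-1)/2}.$$ Also, $\|X\|_{[3;\mathbf{R}^d\times\mathbf{R}]}$ vanishes unless $H\sim N_1$, and if $L_3\ll N_1$, then it vanishes unless $L_1,L_2\sim N_1$. 2. (High-low interactions) If $N_1\sim N_3\gtrsim N_2$ and $L_2\ll L_{max}$, then $$\|X\|_{[3;\mathbf{R}^d\times\mathbf{R}]} \lesssim \Big(\frac{H}{N_2}\Big)^{(d-3)/4} L_{min}^{1/2}\min(H,L_{med})^{1/2}N_2^{(d-1)/2}.$$ 3. ($(+-)$ high-high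 interactions) If $N_1\sim N_3\gtrsim N_2$ and $L_2\sim L_{max}$, then $$\|X\|_{[3;\mathbf{R}^d\times\mathbf{R}]} \lesssim \Big(\frac{H}{N_2}\Big)^{(d-3)/4} L_{min}^{1/2}\min\Big(H,\frac{N_1}{N_2}L_{med}\Big)^{1/2}N_2^{(d-1)/2}.$$ The same statements hold with the roles of the indices $1$ and $2$ reversed. Here the constants are as follows. Every $\sim$ in the definition of $X$ is $A^{-1}y\le x\le Ay$ for a fixed but arbitrary $A\ge1$. There is $K>1$, depending only on $d$ and $A$, such that $x\ll y$ (and $y \gg x$) means $Kx\le y$. Every $\sim$, $\lesssim$, $\gtrsim$ in the hypotheses is taken with an arbitrary constant $B\ge1$. Every $\sim$ and $\lesssim$ in the conclusions holds with a constant $C$ depending only on $d,A,B$ (with $K$ fixed by $d$ and $A$). -/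

import Mathlib

open scoped ENNReal

noncomputable section

/-- `x ∼ y` with implied constant `A`. -/
def SimBy (A x y : ℝ) : Prop := x ≤ A * y ∧ y ≤ A * x

/-- The largest of three numbers. -/
def tripleMax (N : Fin 3 → ℝ) : ℝ := max (N 0) (max (N 1) (N 2))

/-- The median of three numbers. -/
def tripleMed (N : Fin 3 → ℝ) : ℝ :=
  max (min (N 0) (N 1)) (max (min (N 1) (N 2)) (min (N 2) (N 0)))

/-- The smallest of three numbers. -/
def tripleMin (N : Fin 3 → ℝ) : ℝ := min (N 0) (min (N 1) (N 2))

/-- The point `(x, y, -x-y)` of `Γ₃(Z) = {(ξ₁, ξ₂, ξ₃) ∈ Z³ : ξ₁ + ξ₂ + ξ₃ = 0}`. -/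
def gammaPoint {Z : Type*} [AddCommGroup Z] (p : Z × Z) : Fin 3 → Z := ![p.1, p.2, -p.1 - p.2]

/-- The multiplier norm `‖m‖_[3;Z]`: the least constant `c ∈ [0, ∞]` such that
`|∫_{Γ₃(Z)} m(ξ) f₁(ξ₁) f₂(ξ₂) f₃(ξ₃)| ≤ c ‖f₁‖₂ ‖f₂‖₂ ‖f₃‖₂`
for all test functions (continuous with compact support) `f₁, f₂, f₃ : Z → ℂ`. The integral over
`Γ₃(Z)` is taken in the coordinates `(ξ₁, ξ₂)`. It is meant for measurable, locally bounded `m`,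
for which the integrand is integrable. -/
def multiplierNorm3 {Z : Type*} [AddCommGroup Z] [TopologicalSpace Z] [MeasureTheory.MeasureSpace Z]
    (m : (Fin 3 → Z) → ℂ) : ℝ≥0∞ :=
  sInf {c : ℝ≥0∞ | ∀ f : Fin 3 → Z → ℂ,
    (∀ j, Continuous (f j)) → (∀ j, HasCompactSupport (f j)) →
      ‖∫ p : Z × Z, m (gammaPoint p) * ∏ j, f j (gammaPoint p j)‖ₑ ≤
        c * ∏ j, MeasureTheory.eLpNorm (f j) 2 MeasureTheory.volume}

/-- Space-time frequency space `ℝ^d × ℝ`, with points `(ξ, τ)`. -/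
abbrev FreqSpace (d : ℕ) : Type := EuclideanSpace ℝ (Fin d) × ℝ

/-- The modulation `λ_j = τ_j - ε_j |ξ_j|` of a frequency for the relation `τ = ε |ξ|`. -/
def waveModulation {d : ℕ} (ε : ℝ) (z : FreqSpace d) : ℝ := z.2 - ε * ‖z.1‖

/-- The resonance function `h(ξ) = ε₁ |ξ₁| + ε₂ |ξ₂| + ε₃ |ξ₃|`. -/
def waveResonance {d : ℕ} (ε : Fin 3 → ℝ) (z : Fin 3 → FreqSpace d) : ℝ :=
  ∑ j, ε j * ‖(z j).1‖

open scoped Classical in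
/-- The dyadic block `X_{N;H;L;ε}`, the indicator function of the set where `|h(ξ)| ∼ H` and, for
each `j`, `|ξ_j| ∼ N_j`, `ε_j τ_j ≥ 0` and `|λ_j| ∼ L_j`. All `∼` carry the constant `A`. -/
def waveBlock (d : ℕ) (A : ℝ) (N L : Fin 3 → ℝ) (H : ℝ) (ε : Fin 3 → ℝ)
    (z : Fin 3 → FreqSpace d) : ℂ :=
  if SimBy A |waveResonance ε z| H ∧
      ∀ j, SimBy A ‖(z j).1‖ (N j) ∧ 0 ≤ ε j * (z j).2 ∧
        SimBy A |waveModulation (ε j) (z j)| (L j)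
  then 1 else 0

/-- The norm `‖X_{N;H;L;ε}‖_{[3; ℝ^d × ℝ]}` in the `(++-)` case `ε = (1, 1, -1)`. -/
def waveBlockNorm (d : ℕ) (A : ℝ) (N L : Fin 3 → ℝ) (H : ℝ) : ℝ≥0∞ :=
  multiplierNorm3 (waveBlock d A N L H ![1, 1, -1])

end

/-!
The bounds come from a trilinear Cauchy-Schwarz inequality: once one of the three frequencies is
fixed, the norm of the block is at most the square root of the measure of the set of possible
values of another one (`triBound_of_fiber`). When the fixed frequency is at most comparable to the
other two, these two nearly cancel and may moreover be localised, to pieces which determine each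
other. In `triBound_of_localized_fiber` the pieces form a family indexed by a measure
space, so that the localisation is an average over their centre and no partition is needed. The
third statement uses cylinders pointing along the localised frequency, the first one balls.

The time variable of a fibre lies in two intervals of lengths comparable to the two modulations
that are left, which gives the factor `min` of these modulations
(`volume_le_of_mem_slab`). What remains is a set of spatial frequencies on which the
resonance function is of size `H` and a sum or difference of two norms lies in an interval of
length comparable to the larger modulation. Two elementary identities,
`2 (|x| |y| - x · y) = h (|x| + |y| + |x + y|)` and
`2 (|y| |x + y| - y · (x + y)) = h (2 |x| - h)` with `h = |x| + |y| - |x + y|`, turn `|h| ∼ H` into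
bounds for the angles between the frequencies: they place the set in a cylinder of length `≈ N₂`
and radius `ρ = (N₂ H)^{1/2}`, and they bound from below the derivative of the sum or difference of
norms along rays (`volume_first_fixed_le`, `volume_third_fixed_le`) or along a fixed direction
(`volume_second_fixed_le`, `volume_sum_slab_le`). Convexity of the norm then bounds the length of
the intersection of the set with these lines, and averaging over dilations or translations
(`volume_le_of_dilate`, `volume_le_of_translate`) turns this into a bound for its measure, without
polar coordinates.

The derivative degenerates when the fixed frequency is the first or the second and has almost the
same direction as the third. The sign condition on the time frequency of the fixed point excludes
this unless the larger modulation is so large that the bound by the measure of the cylinder is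
enough.

The choice of the fixed frequency follows from the sizes of the modulations: in the first statement
the first one or the third one (`high_high_bound`), in the second statement the one of maximal
modulation (`high_low_bound`), in the third statement the low one (`plus_minus_high_high_bound`).
-/

open MeasureTheory
open scoped RealInnerProductSpace

/-! ### Trilinear estimates on triples of sum zero -/

/-- The `L²` norm of a nonnegative function, as an extended nonnegative number. -/
noncomputable def l2Norm {Z : Type*} [MeasureSpace Z] (g : Z → ℝ≥0∞) : ℝ≥0∞ :=
  (∫⁻ z, g z ^ (2 : ℝ)) ^ (1 / 2 : ℝ)

/-- The trilinear estimate with constant `c` for the indicator function of the set `E` of triples,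
restricted to the triples `(x, w, -x - w)` of sum zero and tested on nonnegative functions. -/
def TriBound {Z : Type*} [AddCommGroup Z] [MeasureSpace Z] (E : Set (Z × Z × Z)) (c : ℝ≥0∞) :
    Prop :=
  ∀ g₁ g₂ g₃ : Z → ℝ≥0∞, Measurable g₁ → Measurable g₂ → Measurable g₃ →
    ∫⁻ x, ∫⁻ w, E.indicator 1 (x, w, -x - w) * (g₁ x * g₂ w * g₃ (-x - w)) ≤
      c * (l2Norm g₁ * l2Norm g₂ * l2Norm g₃)

theorem measurable_triple_integrand {Z : Type*} [AddCommGroup Z] [MeasureSpace Z]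
    [MeasurableAdd₂ Z] [MeasurableNeg Z] {E : Set (Z × Z × Z)} (hE : MeasurableSet E)
    {g₁ g₂ g₃ : Z → ℝ≥0∞} (h₁ : Measurable g₁) (h₂ : Measurable g₂) (h₃ : Measurable g₃) :
    Measurable fun p : Z × Z =>
      E.indicator (1 : Z × Z × Z → ℝ≥0∞) (p.1, p.2, -p.1 - p.2) *
        (g₁ p.1 * g₂ p.2 * g₃ (-p.1 - p.2)) := by
  have : Measurable fun p : Z × Z => -p.1 - p.2 := by
    simp only [sub_eq_add_neg]; fun_prop
  have h4 : Measurable (E.indicator (1 : Z × Z × Z → ℝ≥0∞)) := measurable_one.indicator hE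
  fun_prop

theorem TriBound.mono_set {Z : Type*} [AddCommGroup Z] [MeasureSpace Z]
    {E F : Set (Z × Z × Z)} {c : ℝ≥0∞} (h : TriBound F c)
    (hEF : ∀ q ∈ E, q ∈ F) : TriBound E c := by
  intro g₁ g₂ g₃ h₁ h₂ h₃
  refine le_trans ?_ (h g₁ g₂ g₃ h₁ h₂ h₃)
  gcongr with x w
  exact hEF

theorem TriBound.swap₁₂ {Z : Type*} [AddCommGroup Z] [MeasureSpace Z] [MeasurableAdd₂ Z]
    [MeasurableNeg Z] [SFinite (volume : Measure Z)] {E : Set (Z × Z × Z)} {c : ℝ≥0∞}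
    (hE : MeasurableSet E) (h : TriBound {q | (q.2.1, q.1, q.2.2) ∈ E} c) : TriBound E c := by
  intro g₁ g₂ g₃ h₁ h₂ h₃
  rw [lintegral_lintegral_swap (measurable_triple_integrand hE h₁ h₂ h₃).aemeasurable]
  refine le_trans (le_of_eq ?_) ((h g₂ g₁ g₃ h₂ h₁ h₃).trans (le_of_eq (by ring)))
  refine lintegral_congr fun x => lintegral_congr fun w => ?_
  have e : -w - x = -x - w := by abel
  rw [e, mul_comm (g₁ w)]
  rfl

theorem TriBound.swap₂₃ {Z : Type*} [AddCommGroup Z] [MeasureSpace Z] [MeasurableAdd₂ Z]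
    [MeasurableNeg Z] [(volume : Measure Z).IsAddLeftInvariant]
    [(volume : Measure Z).IsNegInvariant] {E : Set (Z × Z × Z)} {c : ℝ≥0∞}
    (h : TriBound {q | (q.1, q.2.2, q.2.1) ∈ E} c) : TriBound E c := by
  intro g₁ g₂ g₃ h₁ h₂ h₃
  refine le_trans (le_of_eq ?_) ((h g₁ g₃ g₂ h₁ h₃ h₂).trans (le_of_eq (by ring)))
  refine lintegral_congr fun x => ?_
  rw [← lintegral_sub_left_eq_self _ (-x)]
  refine lintegral_congr fun w => ?_
  have e : -x - (-x - w) = w := by abel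
  rw [e, mul_right_comm]
  rfl

/-- Localised Cauchy-Schwarz. The second and third frequency are localised by a family of sets
`W₁ y`, `W₂ y` indexed by a measure space; if the localisation of the second forces that of the
third, then one only has to bound the localised fibres over a fixed first frequency. -/
theorem triBound_of_localized_fiber {Z : Type*} [AddCommGroup Z] [MeasureSpace Z] [MeasurableAdd₂ Z]
    [MeasurableNeg Z] [SFinite (volume : Measure Z)] [(volume : Measure Z).IsAddLeftInvariant]
    [(volume : Measure Z).IsNegInvariant] 
    {Y : Type*} [MeasurableSpace Y] (ν : Measure Y) [SFinite ν]
    {E : Set (Z × Z × Z)} (hE : MeasurableSet E) {W₁ W₂ : Set (Z × Y)}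
    (hW₁ : MeasurableSet W₁) (hW₂ : MeasurableSet W₂)
    (hW : ∀ q ∈ E, ∀ y, (q.2.1, y) ∈ W₁ → (q.2.2, y) ∈ W₂)
    {a b₁ b₂ M : ℝ≥0∞} (ha : ∀ q ∈ E, a ≤ ν {y | (q.2.1, y) ∈ W₁})
    (hb₁ : ∀ z, ν {y | (z, y) ∈ W₁} ≤ b₁) (hb₂ : ∀ z, ν {y | (z, y) ∈ W₂} ≤ b₂)
    (hM : ∀ x y, volume {w | (x, w, -x - w) ∈ E ∧ (w, y) ∈ W₁} ≤ M)
    (ha0 : a ≠ 0) (ha' : a ≠ ∞) :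
    TriBound E ((M * b₁ * b₂) ^ (1 / 2 : ℝ) / a) := by
  intro g₁ g₂ g₃ h₁ h₂ h₃
  have hi : Measurable fun p : Z × Z => -p.1 - p.2 := by
    simp only [sub_eq_add_neg]; fun_prop
  have hEm : Measurable (E.indicator (1 : Z × Z × Z → ℝ≥0∞)) := measurable_one.indicator hE
  have hW₁m : Measurable (W₁.indicator (1 : Z × Y → ℝ≥0∞)) := measurable_one.indicator hW₁
  have hW₂m : Measurable (W₂.indicator (1 : Z × Y → ℝ≥0∞)) := measurable_one.indicator hW₂
  rw [← lintegral_prod (μ := (volume : Measure Z)) (ν := (volume : Measure Z)) _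
    (measurable_triple_integrand hE h₁ h₂ h₃).aemeasurable]
  set F : Z × Z → Y → ℝ≥0∞ := fun p y => E.indicator 1 (p.1, p.2, -p.1 - p.2) *
    W₁.indicator 1 (p.2, y) * g₁ p.1 with hF
  set G : Z × Z → Y → ℝ≥0∞ := fun p y => (W₁.indicator 1 (p.2, y) * g₂ p.2) *
    (W₂.indicator 1 (-p.1 - p.2, y) * g₃ (-p.1 - p.2)) with hG
  set φ : Y → ℝ≥0∞ := fun y => ∫⁻ w, W₁.indicator 1 (w, y) * g₂ w ^ (2 : ℝ) with hφ
  set ψ : Y → ℝ≥0∞ := fun y => ∫⁻ w, W₂.indicator 1 (w, y) * g₃ w ^ (2 : ℝ) with hψ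
  have hFm : Measurable (Function.uncurry F) := by
    simp only [hF, Function.uncurry_def]; fun_prop
  have hGm : Measurable (Function.uncurry G) := by
    simp only [hG, Function.uncurry_def]; fun_prop
  have key : a * ∫⁻ p : Z × Z, E.indicator 1 (p.1, p.2, -p.1 - p.2) *
        (g₁ p.1 * g₂ p.2 * g₃ (-p.1 - p.2)) ∂(volume.prod volume) ≤
      ∫⁻ y, (∫⁻ p, F p y * G p y ∂(volume.prod volume)) ∂ν := by
    rw [← lintegral_const_mul _ (measurable_triple_integrand hE h₁ h₂ h₃)]
    rw [← lintegral_lintegral_swap (hFm.mul hGm).aemeasurable]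
    refine lintegral_mono fun p => ?_
    by_cases hp : (p.1, p.2, -p.1 - p.2) ∈ E
    · have : ∀ y, F p y * G p y = ({y | (p.2, y) ∈ W₁}.indicator 1 y) *
          (g₁ p.1 * g₂ p.2 * g₃ (-p.1 - p.2)) := by
        intro y
        by_cases hy : (p.2, y) ∈ W₁
        · have := hW _ hp y hy
          simp only at this
          simp [hF, hG, hp, hy, this, mul_assoc]
        · simp [hF, hG, hy]
      simp only [this]
      have hm : MeasurableSet {y | (p.2, y) ∈ W₁} := measurable_prodMk_left hW₁
      rw [lintegral_mul_const _ (measurable_one.indicator hm), lintegral_indicator_one hm]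
      simp only [hp, Set.indicator_of_mem, Pi.one_apply, one_mul]
      gcongr
      exact ha _ hp
    · simp [hp]
  have cs : ∀ y, ∫⁻ p, F p y * G p y ∂(volume.prod volume) ≤
      (M ^ (1 / 2 : ℝ) * l2Norm g₁) * (φ y ^ (1 / 2 : ℝ) * ψ y ^ (1 / 2 : ℝ)) := by
    intro y
    have hFy : Measurable fun p => F p y := by simp only [hF]; fun_prop
    have hGy : Measurable fun p => G p y := by simp only [hG]; fun_prop
    refine (ENNReal.lintegral_mul_le_Lp_mul_Lq _ Real.HolderConjugate.two_two hFy.aemeasurable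
      hGy.aemeasurable).trans ?_
    refine mul_le_mul' ?_ ?_
    · rw [l2Norm, ← ENNReal.mul_rpow_of_nonneg _ _ (by norm_num)]
      gcongr
      rw [lintegral_prod _ (by fun_prop), ← lintegral_const_mul _ (by fun_prop)]
      refine lintegral_mono fun x => ?_
      simp only [hF]
      have hm : MeasurableSet {w | (x, w, -x - w) ∈ E ∧ (w, y) ∈ W₁} := by
        refine MeasurableSet.inter ?_ ?_
        · have : Measurable fun w : Z => (x, w, -x - w) := by
            simp only [sub_eq_add_neg]; fun_prop
          exact this hE
        · exact measurable_prodMk_right hW₁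
      have : ∀ w, (E.indicator 1 (x, w, -x - w) * W₁.indicator 1 (w, y) * g₁ x) ^ (2 : ℝ) =
          {w | (x, w, -x - w) ∈ E ∧ (w, y) ∈ W₁}.indicator 1 w * g₁ x ^ (2 : ℝ) := by
        intro w
        by_cases h1 : (x, w, -x - w) ∈ E <;> by_cases h2 : (w, y) ∈ W₁ <;> simp [h1, h2]
      simp only [this]
      rw [lintegral_mul_const _ (measurable_one.indicator hm), lintegral_indicator_one hm]
      gcongr
      exact hM x y
    · rw [← ENNReal.mul_rpow_of_nonneg _ _ (by norm_num)]
      gcongr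
      rw [lintegral_prod_symm _ (by fun_prop), hφ, hψ]
      simp only
      rw [← lintegral_mul_const _ (by fun_prop)]
      refine lintegral_mono fun w => ?_
      have e1 : ∀ x, G (x, w) y ^ (2 : ℝ) = (W₁.indicator 1 (w, y) * g₂ w ^ (2 : ℝ)) *
          (fun v => W₂.indicator 1 (v, y) * g₃ v ^ (2 : ℝ)) (-w - x) := by
        intro x
        have e : -x - w = -w - x := by abel
        by_cases h1 : (w, y) ∈ W₁ <;> by_cases h2 : (-w - x, y) ∈ W₂ <;>
          simp [hG, h1, h2, e, mul_pow]
      simp only [e1]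
      rw [lintegral_const_mul _ (by simp only [sub_eq_add_neg]; fun_prop),
        lintegral_sub_left_eq_self (fun v => W₂.indicator 1 (v, y) * g₃ v ^ (2 : ℝ)) (-w)]
  have fin : ∀ (W : Set (Z × Y)) (b : ℝ≥0∞) (g : Z → ℝ≥0∞), MeasurableSet W → Measurable g →
      (∀ z, ν {y | (z, y) ∈ W} ≤ b) →
      ∫⁻ y, ∫⁻ w, W.indicator 1 (w, y) * g w ^ (2 : ℝ) ∂volume ∂ν ≤
        b * ∫⁻ w, g w ^ (2 : ℝ) := by
    intro W b g hWm hg hb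
    have hWi : Measurable (W.indicator (1 : Z × Y → ℝ≥0∞)) := measurable_one.indicator hWm
    rw [lintegral_lintegral_swap (by simp only [Function.uncurry_def]; fun_prop),
      ← lintegral_const_mul _ (by fun_prop)]
    refine lintegral_mono fun w => ?_
    have hm : MeasurableSet {y | (w, y) ∈ W} := measurable_prodMk_left hWm
    rw [lintegral_mul_const _ (by fun_prop)]
    have : ∫⁻ y, W.indicator 1 (w, y) ∂ν = ν {y | (w, y) ∈ W} := by
      rw [← lintegral_indicator_one hm]; rfl
    rw [this]
    gcongr
    exact hb w
  have hφm : Measurable φ := by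
    have : Measurable (Function.uncurry fun (y : Y) (w : Z) =>
      W₁.indicator (1 : Z × Y → ℝ≥0∞) (w, y) * g₂ w ^ (2 : ℝ)) := by
      simp only [Function.uncurry_def]; fun_prop
    exact this.lintegral_prod_right
  have hψm : Measurable ψ := by
    have : Measurable (Function.uncurry fun (y : Y) (w : Z) =>
      W₂.indicator (1 : Z × Y → ℝ≥0∞) (w, y) * g₃ w ^ (2 : ℝ)) := by
      simp only [Function.uncurry_def]; fun_prop
    exact this.lintegral_prod_right
  have cs2 : ∫⁻ y, φ y ^ (1 / 2 : ℝ) * ψ y ^ (1 / 2 : ℝ) ∂ν ≤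
      (b₁ ^ (1 / 2 : ℝ) * l2Norm g₂) * (b₂ ^ (1 / 2 : ℝ) * l2Norm g₃) := by
    refine (ENNReal.lintegral_mul_le_Lp_mul_Lq _ Real.HolderConjugate.two_two
      (by fun_prop) (by fun_prop)).trans ?_
    have e : ∀ t : ℝ≥0∞, (t ^ (1 / 2 : ℝ)) ^ (2 : ℝ) = t := by
      intro t; rw [← ENNReal.rpow_mul]; norm_num
    simp only [e]
    refine mul_le_mul' ?_ ?_
    · rw [l2Norm, ← ENNReal.mul_rpow_of_nonneg _ _ (by norm_num)]
      gcongr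
      exact fin W₁ b₁ g₂ hW₁ h₂ hb₁
    · rw [l2Norm, ← ENNReal.mul_rpow_of_nonneg _ _ (by norm_num)]
      gcongr
      exact fin W₂ b₂ g₃ hW₂ h₃ hb₂
  have tot := key.trans (lintegral_mono cs)
  rw [lintegral_const_mul _ (by fun_prop)] at tot
  have tot2 := tot.trans (mul_le_mul_right cs2 _)
  rw [mul_comm a, ← ENNReal.le_div_iff_mul_le (Or.inl ha0) (Or.inl ha')] at tot2
  refine tot2.trans (le_of_eq ?_)
  rw [ENNReal.mul_rpow_of_nonneg _ _ (by norm_num), ENNReal.mul_rpow_of_nonneg _ _ (by norm_num)]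
  simp only [div_eq_mul_inv]
  ring

/-- Cauchy-Schwarz: a bound for the fibres over the first frequency. -/
theorem triBound_of_fiber {Z : Type*} [AddCommGroup Z] [MeasureSpace Z] [MeasurableAdd₂ Z]
    [MeasurableNeg Z] [SFinite (volume : Measure Z)] [(volume : Measure Z).IsAddLeftInvariant]
    [(volume : Measure Z).IsNegInvariant] 
    {E : Set (Z × Z × Z)} (hE : MeasurableSet E) {M : ℝ≥0∞}
    (hM : ∀ x, volume {w | (x, w, -x - w) ∈ E} ≤ M) :
    TriBound E (M ^ (1 / 2 : ℝ)) := by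
  have := triBound_of_localized_fiber (Measure.dirac ()) hE (W₁ := Set.univ) (W₂ := Set.univ)
    MeasurableSet.univ MeasurableSet.univ (by simp) (a := 1) (b₁ := 1) (b₂ := 1) (M := M)
    (by simp) (by simp) (by simp) (by simpa using hM) (by simp) (by simp)
  simpa using this
theorem multiplierNorm3_le_of_triBound {Z : Type*} [AddCommGroup Z] [TopologicalSpace Z]
    [MeasureSpace Z] [BorelSpace Z] [MeasurableAdd₂ Z] [MeasurableNeg Z]
    [SFinite (volume : Measure Z)] {E : Set (Z × Z × Z)} (hE : MeasurableSet E) {c : ℝ≥0∞}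
    (h : TriBound E c) {m : (Fin 3 → Z) → ℂ}
    (hm : ∀ p : Z × Z, ‖m (gammaPoint p)‖ₑ ≤ E.indicator 1 (p.1, p.2, -p.1 - p.2)) :
    multiplierNorm3 m ≤ c := by
  refine sInf_le fun f hf _ => ?_
  refine (enorm_integral_le_lintegral_enorm _).trans ?_
  have hfm : ∀ j, Measurable fun z => ‖f j z‖ₑ := fun j =>
    (hf j).enorm.measurable
  have := h _ _ _ (hfm 0) (hfm 1) (hfm 2)
  have e := lintegral_prod (μ := (volume : Measure Z)) (ν := (volume : Measure Z)) _
    (measurable_triple_integrand hE (hfm 0) (hfm 1) (hfm 2)).aemeasurable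
  simp only at e
  rw [← e] at this
  refine le_trans (lintegral_mono fun p => ?_) (this.trans (le_of_eq ?_))
  · simp only [enorm_mul, Fin.prod_univ_three]
    gcongr
    · exact hm _
    · simp [gammaPoint]
    · simp [gammaPoint]
    · simp [gammaPoint]
  · simp only [Fin.prod_univ_three, l2Norm]
    simp [eLpNorm_eq_lintegral_rpow_enorm_toReal]

/-! ### Directions and orthogonal components -/

section Geometry

/-- The component of `x` orthogonal to `u` (all of `x` when `u = 0`). -/
noncomputable def perp {V : Type*} [NormedAddCommGroup V] [InnerProductSpace ℝ V] (u x : V) : V :=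
  x - (⟪u, x⟫ / ‖u‖ ^ 2) • u

/-- The direction `x / |x|` of a vector. -/
noncomputable def dir {V : Type*} [NormedAddCommGroup V] [InnerProductSpace ℝ V] (x : V) : V :=
  ‖x‖⁻¹ • x

variable {V : Type*} [NormedAddCommGroup V] [InnerProductSpace ℝ V]

theorem perp_add (u x y : V) : perp u (x + y) = perp u x + perp u y := by
  simp only [perp, inner_add_right, add_div, add_smul]; abel

theorem perp_smul (u x : V) (c : ℝ) : perp u (c • x) = c • perp u x := by
  simp only [perp, inner_smul_right, smul_sub, smul_smul]; congr 2; ring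

theorem perp_neg (u x : V) : perp u (-x) = -perp u x := by
  simpa using perp_smul u x (-1)

theorem perp_sub (u x y : V) : perp u (x - y) = perp u x - perp u y := by
  rw [sub_eq_add_neg, perp_add, perp_neg, sub_eq_add_neg]

theorem perp_self (u : V) : perp u u = 0 := by
  by_cases hu : u = 0
  · simp [perp, hu]
  · have : ‖u‖ ≠ 0 := norm_ne_zero_iff.2 hu
    rw [perp, real_inner_self_eq_norm_sq, div_self (by positivity), one_smul, sub_self]

theorem norm_sq_mul_norm_perp_sq (u x : V) :
    ‖u‖ ^ 2 * ‖perp u x‖ ^ 2 = ‖u‖ ^ 2 * ‖x‖ ^ 2 - ⟪u, x⟫ ^ 2 := by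
  by_cases hu : u = 0
  · simp [hu]
  · have : ‖u‖ ≠ 0 := norm_ne_zero_iff.2 hu
    rw [perp, norm_sub_sq_real, inner_smul_right, norm_smul, real_inner_comm, mul_pow,
      Real.norm_eq_abs, sq_abs]
    field_simp
    ring

theorem norm_perp_le (u x : V) : ‖perp u x‖ ≤ ‖x‖ := by
  by_cases hu : u = 0
  · simp [perp, hu]
  · have hu : 0 < ‖u‖ := norm_pos_iff.2 hu
    have := norm_sq_mul_norm_perp_sq u x
    have h2 : ‖u‖ ^ 2 * ‖perp u x‖ ^ 2 ≤ ‖u‖ ^ 2 * ‖x‖ ^ 2 := by nlinarith [sq_nonneg ⟪u, x⟫]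
    exact (sq_le_sq₀ (norm_nonneg _) (norm_nonneg _)).1 (le_of_mul_le_mul_left h2 (by positivity))

/-- The orthogonal component is the shortest representative modulo multiples of `u`. -/
theorem norm_perp_le_norm_sub_smul (u x : V) (c : ℝ) : ‖perp u x‖ ≤ ‖x - c • u‖ := by
  have := norm_perp_le u (x - c • u)
  rwa [perp_sub, perp_smul, perp_self, smul_zero, sub_zero] at this

theorem norm_mul_norm_perp_sq_le (u x : V) :
    ‖u‖ * ‖perp u x‖ ^ 2 ≤ 2 * ‖x‖ * (‖u‖ * ‖x‖ - ⟪u, x⟫) := by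
  by_cases hu : u = 0
  · simp [hu]
  · have hu : 0 < ‖u‖ := norm_pos_iff.2 hu
    have h := norm_sq_mul_norm_perp_sq u x
    have h1 := real_inner_le_norm u x
    have h2 := neg_le_of_abs_le (abs_real_inner_le_norm u x)
    have : ‖u‖ * (‖u‖ * ‖perp u x‖ ^ 2) ≤ ‖u‖ * (2 * ‖x‖ * (‖u‖ * ‖x‖ - ⟪u, x⟫)) := by
      nlinarith [mul_nonneg (sub_nonneg.2 h1) (sub_nonneg.2 h1)]
    exact le_of_mul_le_mul_left this hu

theorem norm_dir {x : V} (hx : x ≠ 0) : ‖dir x‖ = 1 := by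
  have : ‖x‖ ≠ 0 := norm_ne_zero_iff.2 hx
  rw [dir, norm_smul, norm_inv, norm_norm, inv_mul_cancel₀ this]

theorem norm_dir_le (x : V) : ‖dir x‖ ≤ 1 := by
  by_cases hx : x = 0
  · simp [dir, hx]
  · exact (norm_dir hx).le

theorem inner_dir_self (x : V) : ⟪dir x, x⟫ = ‖x‖ := by
  by_cases hx : x = 0
  · simp [dir, hx]
  · have : ‖x‖ ≠ 0 := norm_ne_zero_iff.2 hx
    rw [dir, real_inner_smul_left, real_inner_self_eq_norm_sq]
    field_simp

theorem norm_dir_sub_dir_sq {u w : V} (hu : u ≠ 0) (hw : w ≠ 0) :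
    ‖dir u - dir w‖ ^ 2 * (‖u‖ * ‖w‖) = 2 * (‖u‖ * ‖w‖ - ⟪u, w⟫) := by
  have h1 : ‖u‖ ≠ 0 := norm_ne_zero_iff.2 hu
  have h2 : ‖w‖ ≠ 0 := norm_ne_zero_iff.2 hw
  rw [norm_sub_sq_real, norm_dir hu, norm_dir hw, dir, dir, real_inner_smul_left,
    inner_smul_right]
  field_simp
  ring

/-- Supporting hyperplane of the norm at `x`. -/
theorem norm_add_ge (x y : V) : ‖x‖ + ⟪dir x, y⟫ ≤ ‖x + y‖ := by
  have h := real_inner_le_norm (dir x) (x + y)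
  rw [inner_add_right, inner_dir_self] at h
  exact h.trans (mul_le_of_le_one_left (norm_nonneg _) (norm_dir_le x))

theorem perp_eq_dir (u x : V) : perp u x = x - ⟪dir u, x⟫ • dir u := by
  rw [perp, dir, real_inner_smul_left, smul_smul]
  congr 2
  ring

/-- Effect of a change of axis on the orthogonal component. -/
theorem norm_perp_change (u w x : V) :
    ‖perp w x‖ ≤ ‖perp u x‖ + ‖x‖ * ‖dir u - dir w‖ := by
  have h := norm_perp_le_norm_sub_smul w x (⟪dir u, x⟫ * ‖w‖⁻¹)
  have e : x - (⟪dir u, x⟫ * ‖w‖⁻¹) • w = perp u x + ⟪dir u, x⟫ • (dir u - dir w) := by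
    rw [perp_eq_dir, smul_sub, mul_smul]; simp only [dir]; abel
  rw [e] at h
  refine h.trans ((norm_add_le _ _).trans ?_)
  gcongr
  rw [norm_smul]
  gcongr
  refine (abs_real_inner_le_norm _ _).trans ?_
  exact mul_le_of_le_one_left (norm_nonneg _) (norm_dir_le u)

/-- For vectors at an acute angle, the angle is controlled by its sine. -/
theorem norm_dir_sub_dir_mul_le {u w : V} (hu : u ≠ 0) (hw : w ≠ 0) (h : 0 ≤ ⟪u, w⟫) :
    ‖dir u - dir w‖ * ‖w‖ ≤ 2 * ‖perp u w‖ := by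
  have h1 : 0 < ‖u‖ := norm_pos_iff.2 hu
  have h2 : 0 < ‖w‖ := norm_pos_iff.2 hw
  have a := norm_dir_sub_dir_sq hu hw
  have b := norm_sq_mul_norm_perp_sq u w
  have c := real_inner_le_norm u w
  have key : ‖u‖ ^ 2 * (‖dir u - dir w‖ * ‖w‖) ^ 2 ≤ ‖u‖ ^ 2 * (2 * ‖perp u w‖) ^ 2 := by
    have e : ‖u‖ ^ 2 * (‖dir u - dir w‖ * ‖w‖) ^ 2 =
      (‖u‖ * ‖w‖) * (2 * (‖u‖ * ‖w‖ - ⟪u, w⟫)) := by rw [← a]; ring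
    rw [e]
    nlinarith [mul_nonneg (sub_nonneg.2 c) h]
  exact (sq_le_sq₀ (by positivity) (by positivity)).1 (le_of_mul_le_mul_left key (by positivity))

/-- The resonance function `h = |x| + |y| - |x + y|` measures the angle between `x` and `y`. -/
theorem two_mul_norm_mul_sub_inner (x y : V) :
    2 * (‖x‖ * ‖y‖ - ⟪x, y⟫) = (‖x‖ + ‖y‖ - ‖x + y‖) * (‖x‖ + ‖y‖ + ‖x + y‖) := by
  have := norm_add_sq_real x y
  linarith

/-- The resonance function also measures the angle between `y` and `x + y`, up to the factor
`2 |x| - h`, which is small when `x` and `x + y` have almost opposite directions. -/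
theorem two_mul_norm_mul_add_sub_inner (x y : V) :
    2 * (‖y‖ * ‖x + y‖ - ⟪y, x + y⟫) =
      (‖x‖ + ‖y‖ - ‖x + y‖) * (2 * ‖x‖ - (‖x‖ + ‖y‖ - ‖x + y‖)) := by
  have := norm_add_sq_real x y
  rw [inner_add_right, real_inner_self_eq_norm_sq, real_inner_comm]
  linarith

theorem map_perp {V' : Type*} [NormedAddCommGroup V'] [InnerProductSpace ℝ V'] (e : V ≃ₗᵢ[ℝ] V')
    (u x : V) : perp (e u) (e x) = e (perp u x) := by
  simp [perp]

end Geometry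

/-! ### Cylinders -/

section Cylinder

/-- The cylinder centred at the origin with axis `u` and radius `s`, cut off by the ball of radius
`r` rather than by two hyperplanes. -/
def cyl {V : Type*} [NormedAddCommGroup V] [InnerProductSpace ℝ V] (u : V) (r s : ℝ) : Set V :=
  {x | ‖x‖ ≤ r ∧ ‖perp u x‖ ≤ s}

variable {d : ℕ}

theorem exists_isometry_apply_eq_single [NeZero d] {u : EuclideanSpace ℝ (Fin d)} (hu : u ≠ 0) :
    ∃ e : EuclideanSpace ℝ (Fin d) ≃ₗᵢ[ℝ] EuclideanSpace ℝ (Fin d),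
      e (dir u) = EuclideanSpace.single 0 1 := by
  have ho : Orthonormal ℝ (({0} : Set (Fin d)).domRestrict fun _ => dir u) := by
    constructor
    · intro i; exact norm_dir hu
    · intro i j hij
      exact absurd (Subsingleton.elim i j) hij
  obtain ⟨b, hb⟩ := ho.exists_orthonormalBasis_extension_of_card_eq (ι := Fin d) (by simp)
  refine ⟨b.repr, ?_⟩
  rw [← hb 0 rfl, b.repr_self]

theorem perp_dir {V : Type*} [NormedAddCommGroup V] [InnerProductSpace ℝ V] (u x : V) :
    perp (dir u) x = perp u x := by
  by_cases hu : u = 0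
  · simp [hu, dir]
  · rw [perp_eq_dir u, perp, norm_dir hu]; simp

/-- The volume of a cylinder does not depend on the direction of its axis. -/
theorem volume_cyl_eq [NeZero d] {u : EuclideanSpace ℝ (Fin d)} (hu : u ≠ 0) (r s : ℝ) :
    volume (cyl u r s) = volume (cyl (EuclideanSpace.single (0 : Fin d) (1 : ℝ)) r s) := by
  obtain ⟨e, he⟩ := exists_isometry_apply_eq_single hu
  rw [← e.measurePreserving.measure_preimage_equiv (f := e.toMeasurableEquiv)
    (cyl (EuclideanSpace.single (0 : Fin d) (1 : ℝ)) r s)]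
  congr 1
  ext x
  have := map_perp e (dir u) x
  rw [he, perp_dir] at this
  simp [cyl, this]

theorem volume_cyl_le [NeZero d] {u : EuclideanSpace ℝ (Fin d)} (hu : u ≠ 0) {r s : ℝ}
    (hr : 0 ≤ r) (hs : 0 ≤ s) :
    volume (cyl u r s) ≤ ENNReal.ofReal (2 ^ d * (r * s ^ (d - 1))) := by
  rw [volume_cyl_eq hu]
  set a : Fin d → ℝ := fun i => if i = 0 then r else s with ha
  have hsub : cyl (EuclideanSpace.single (0 : Fin d) (1 : ℝ)) r s ⊆
      (MeasurableEquiv.toLp 2 (Fin d → ℝ)).symm ⁻¹' (Set.Icc (-a) a) := by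
    rintro x ⟨h1, h2⟩
    have : ∀ i, |x i| ≤ a i := by
      intro i
      by_cases hi : i = 0
      · simp only [ha, hi, if_true]
        exact (PiLp.norm_apply_le x 0).trans h1
      · simp only [ha, hi, if_false]
        refine le_trans (le_of_eq ?_)
          ((PiLp.norm_apply_le (perp (EuclideanSpace.single 0 1) x) i).trans h2)
        simp [perp, hi]
    exact ⟨fun i => (abs_le.1 (this i)).1, fun i => (abs_le.1 (this i)).2⟩
  refine (measure_mono hsub).trans ?_
  rw [(EuclideanSpace.volume_preserving_symm_measurableEquiv_toLp (Fin d)).measure_preimage_equiv,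
    Real.volume_Icc_pi]
  have h0 : ∀ i, 0 ≤ a i := by intro i; simp only [ha]; split_ifs <;> assumption
  rw [← ENNReal.ofReal_prod_of_nonneg (fun i _ => by simpa using h0 i)]
  apply ENNReal.ofReal_le_ofReal
  have : ∀ i, a i - (-a) i = 2 * a i := by intro i; simp; ring
  simp only [this]
  rw [Finset.prod_mul_distrib, Finset.prod_const, Finset.card_univ, Fintype.card_fin]
  gcongr
  rw [← Finset.mul_prod_erase _ _ (Finset.mem_univ (0 : Fin d))]
  simp only [ha, if_true]
  rw [Finset.prod_congr rfl (g := fun _ => s) (fun i hi => if_neg (Finset.ne_of_mem_erase hi))]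
  simp

theorem volume_cyl_smul (u : EuclideanSpace ℝ (Fin d)) (r s : ℝ) {k : ℝ} (hk : 0 < k) :
    volume (cyl u (k * r) (k * s)) = ENNReal.ofReal (k ^ d) * volume (cyl u r s) := by
  have := Measure.addHaar_smul (volume : Measure (EuclideanSpace ℝ (Fin d))) k (cyl u r s)
  rw [finrank_euclideanSpace_fin, abs_of_pos (by positivity)] at this
  rw [← this]
  congr 1
  ext x
  rw [Set.mem_smul_set_iff_inv_smul_mem₀ hk.ne']
  simp only [cyl, Set.mem_ofPred_eq, perp_smul, norm_smul, norm_inv, Real.norm_eq_abs,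
    abs_of_pos hk, inv_mul_le_iff₀ hk]

theorem volume_cyl_ne_zero (u : EuclideanSpace ℝ (Fin d)) {r s : ℝ} (hr : 0 < r) (hs : 0 < s) :
    volume (cyl u r s) ≠ 0 := by
  have : Metric.ball (0 : EuclideanSpace ℝ (Fin d)) (min r s) ⊆ cyl u r s := by
    intro x hx
    rw [mem_ball_zero_iff, lt_min_iff] at hx
    exact ⟨hx.1.le, (norm_perp_le _ _).trans hx.2.le⟩
  intro h
  have h2 := measure_mono_null this h
  exact (Metric.measure_ball_pos volume _ (lt_min hr hs)).ne' h2

theorem volume_cyl_ne_top (u : EuclideanSpace ℝ (Fin d)) (r s : ℝ) :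
    volume (cyl u r s) ≠ ∞ := by
  have : cyl u r s ⊆ Metric.closedBall 0 r := fun x hx => by simpa using hx.1
  exact ((measure_mono this).trans_lt measure_closedBall_lt_top).ne

end Cylinder

/-! ### Averaging over translations and dilations -/

section Averaging
variable {d : ℕ}

theorem volume_le_of_forall_sub_le {T : Set ℝ} {l : ℝ} (h : ∀ s ∈ T, ∀ t ∈ T, s ≤ t → t - s ≤ l) :
    volume T ≤ ENNReal.ofReal l := by
  refine (Real.volume_le_diam T).trans (Metric.ediam_le fun s hs t ht => ?_)
  rw [edist_dist, Real.dist_eq]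
  apply ENNReal.ofReal_le_ofReal
  rcases le_total s t with hst | hst
  · rw [abs_sub_comm, abs_of_nonneg (by linarith)]; exact h s hs t ht hst
  · rw [abs_of_nonneg (by linarith)]; exact h t ht s hs hst

/-- A set whose sections along the direction `v` have length at most `l` is small compared with
any set `D` that contains its translates by `-s v`, `0 ≤ s ≤ T`. -/
theorem volume_le_of_translate {S D : Set (EuclideanSpace ℝ (Fin d))} (hS : MeasurableSet S)
    (v : EuclideanSpace ℝ (Fin d)) {l T : ℝ} (hT : 0 < T)
    (hl : ∀ x ∈ S, ∀ t, 0 ≤ t → x + t • v ∈ S → t ≤ l)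
    (hD : ∀ x, ∀ s ∈ Set.Icc 0 T, x + s • v ∈ S → x ∈ D) :
    volume S ≤ ENNReal.ofReal (l / T) * volume D := by
  have hm : MeasurableSet {p : EuclideanSpace ℝ (Fin d) × ℝ |
      p.1 + p.2 • v ∈ S ∧ p.2 ∈ Set.Icc 0 T} := by
    refine MeasurableSet.inter ?_ (measurable_snd measurableSet_Icc)
    exact (show Measurable fun p : EuclideanSpace ℝ (Fin d) × ℝ => p.1 + p.2 • v by fun_prop) hS
  have h1 := Measure.prod_apply (μ := (volume : Measure (EuclideanSpace ℝ (Fin d))))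
    (ν := (volume : Measure ℝ)) hm
  have h2 := Measure.prod_apply_symm (μ := (volume : Measure (EuclideanSpace ℝ (Fin d))))
    (ν := (volume : Measure ℝ)) hm
  have lower : ENNReal.ofReal T * volume S ≤ ∫⁻ s, volume ((fun x => (x, s)) ⁻¹'
      {p : EuclideanSpace ℝ (Fin d) × ℝ | p.1 + p.2 • v ∈ S ∧ p.2 ∈ Set.Icc 0 T}) := by
    have e : ENNReal.ofReal T * volume S = ∫⁻ s, (Set.Icc 0 T).indicator (fun _ => volume S) s := by
      rw [lintegral_indicator measurableSet_Icc]
      simp [mul_comm]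
    rw [e]
    refine lintegral_mono fun s => ?_
    by_cases hs : s ∈ Set.Icc 0 T
    · rw [Set.indicator_of_mem hs]
      refine le_of_eq ?_
      rw [← measure_preimage_add_right volume (s • v) S]
      congr 1
      ext x
      simp only [Set.mem_preimage, Set.mem_ofPred_eq, hs, and_true]
    · simp [hs]
  have upper : ∫⁻ x, volume (Prod.mk x ⁻¹'
      {p : EuclideanSpace ℝ (Fin d) × ℝ | p.1 + p.2 • v ∈ S ∧ p.2 ∈ Set.Icc 0 T}) ≤
      ENNReal.ofReal l * volume D := by
    refine le_trans (lintegral_mono fun x => ?_) (lintegral_indicator_const_le D _)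
    by_cases hx : x ∈ D
    · rw [Set.indicator_of_mem hx]
      refine volume_le_of_forall_sub_le fun s hs t ht hst => ?_
      refine hl _ hs.1 _ (sub_nonneg.2 hst) ?_
      have : x + s • v + (t - s) • v = x + t • v := by rw [sub_smul]; abel
      rw [this]; exact ht.1
    · rw [Set.indicator_of_notMem hx]
      refine le_of_eq ?_
      convert measure_empty (μ := (volume : Measure ℝ))
      ext s
      simp only [Set.mem_preimage, Set.mem_ofPred_eq, Set.mem_empty_iff_false, iff_false, not_and]
      exact fun h hs => hx (hD x s hs h)
  have h3 := lower.trans ((h2.symm.trans h1).le.trans upper)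
  rw [mul_comm, ← ENNReal.le_div_iff_mul_le (Or.inl (by simpa using hT)) (Or.inl (by simp))] at h3
  refine h3.trans (le_of_eq ?_)
  rw [ENNReal.ofReal_div_of_pos hT, div_eq_mul_inv, div_eq_mul_inv]
  ring

/-- A set whose sections by rays are, relative to their distance from the origin, of length at most
`l` is small compared with any set `D` that contains its dilates by `1 / s`, `1 ≤ s ≤ 2`. -/
theorem volume_le_of_dilate {S D : Set (EuclideanSpace ℝ (Fin d))} (hS : MeasurableSet S)
    {l : ℝ} (hl : ∀ x ∈ S, ∀ μ : ℝ, 1 ≤ μ → μ • x ∈ S → μ - 1 ≤ l)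
    (hD : ∀ x, ∀ s ∈ Set.Icc (1 : ℝ) 2, s • x ∈ S → x ∈ D) :
    volume S ≤ ENNReal.ofReal (2 ^ d * (2 * l)) * volume D := by
  have hm : MeasurableSet {p : EuclideanSpace ℝ (Fin d) × ℝ |
      p.2 • p.1 ∈ S ∧ p.2 ∈ Set.Icc (1 : ℝ) 2} := by
    refine MeasurableSet.inter ?_ (measurable_snd measurableSet_Icc)
    exact (show Measurable fun p : EuclideanSpace ℝ (Fin d) × ℝ => p.2 • p.1 by fun_prop) hS
  have h1 := Measure.prod_apply (μ := (volume : Measure (EuclideanSpace ℝ (Fin d))))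
    (ν := (volume : Measure ℝ)) hm
  have h2 := Measure.prod_apply_symm (μ := (volume : Measure (EuclideanSpace ℝ (Fin d))))
    (ν := (volume : Measure ℝ)) hm
  have lower : volume S ≤ ENNReal.ofReal (2 ^ d) * ∫⁻ s, volume ((fun x => (x, s)) ⁻¹'
      {p : EuclideanSpace ℝ (Fin d) × ℝ | p.2 • p.1 ∈ S ∧ p.2 ∈ Set.Icc (1 : ℝ) 2}) := by
    have e : volume S = ∫⁻ s, (Set.Icc (1 : ℝ) 2).indicator (fun _ => volume S) s := by
      rw [lintegral_indicator measurableSet_Icc]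
      norm_num
    rw [← lintegral_const_mul' _ _ (by simp)]
    refine e.le.trans (lintegral_mono fun s => ?_)
    by_cases hs : s ∈ Set.Icc (1 : ℝ) 2
    · rw [Set.indicator_of_mem hs]
      have hs0 : 0 < s := by linarith [hs.1]
      have := Measure.addHaar_preimage_smul (volume : Measure (EuclideanSpace ℝ (Fin d))) hs0.ne' S
      have e2 : ((fun x => (x, s)) ⁻¹'
        {p : EuclideanSpace ℝ (Fin d) × ℝ | p.2 • p.1 ∈ S ∧ p.2 ∈ Set.Icc (1 : ℝ) 2}) =
        (s • ·) ⁻¹' S := by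
        ext x
        simp only [Set.mem_preimage, Set.mem_ofPred_eq, hs, and_true]
      rw [e2, this, finrank_euclideanSpace_fin, ← mul_assoc, ← ENNReal.ofReal_mul (by positivity),
        abs_of_pos (by positivity)]
      refine le_mul_of_one_le_left (by simp) ?_
      rw [ENNReal.one_le_ofReal, ← div_eq_mul_inv, one_le_div (by positivity)]
      gcongr
      exact hs.2
    · simp [hs]
  have upper : ∫⁻ x, volume (Prod.mk x ⁻¹'
      {p : EuclideanSpace ℝ (Fin d) × ℝ | p.2 • p.1 ∈ S ∧ p.2 ∈ Set.Icc (1 : ℝ) 2}) ≤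
      ENNReal.ofReal (2 * l) * volume D := by
    refine le_trans (lintegral_mono fun x => ?_) (lintegral_indicator_const_le D _)
    by_cases hx : x ∈ D
    · rw [Set.indicator_of_mem hx]
      refine volume_le_of_forall_sub_le fun s hs t ht hst => ?_
      have hs0 : 0 < s := by linarith [hs.2.1]
      have h := hl _ hs.1 (t / s) ((one_le_div hs0).2 hst) (by
        simp only [smul_smul, div_mul_cancel₀ _ hs0.ne']; exact ht.1)
      have : t - s = s * (t / s - 1) := by field_simp
      rw [this]
      have h0 : 0 ≤ t / s - 1 := sub_nonneg.2 ((one_le_div hs0).2 hst)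
      exact mul_le_mul hs.2.2 h h0 (by norm_num)
    · rw [Set.indicator_of_notMem hx]
      refine le_of_eq ?_
      convert measure_empty (μ := (volume : Measure ℝ))
      ext s
      simp only [Set.mem_preimage, Set.mem_ofPred_eq, Set.mem_empty_iff_false, iff_false, not_and]
      exact fun h hs => hx (hD x s hs h)
  refine lower.trans ?_
  rw [ENNReal.ofReal_mul (by positivity), mul_assoc]
  gcongr
  exact (h2.symm.trans h1).le.trans upper

end Averaging

/-! ### Sets of spatial frequencies -/

section SpatialSets
variable {d : ℕ}

theorem le_ofReal_mul_min {x : ℝ≥0∞} {c Q t : ℝ} (h₁ : x ≤ ENNReal.ofReal (c * Q))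
    (h₂ : x ≤ ENNReal.ofReal (c * (Q * t))) : x ≤ ENNReal.ofReal (c * (Q * min 1 t)) := by
  rcases le_total 1 t with h | h
  · rwa [min_eq_left h, mul_one]
  · rwa [min_eq_right h]

theorem measurableSet_and {α : Type*} [MeasurableSpace α] {p q : α → Prop}
    (hp : MeasurableSet {x | p x}) (hq : MeasurableSet {x | q x}) :
    MeasurableSet {x | p x ∧ q x} :=
  hp.inter hq

theorem measurableSet_simBy {α : Type*} [MeasurableSpace α] {f : α → ℝ} (hf : Measurable f)
    (c y : ℝ) : MeasurableSet {x | SimBy c (f x) y} := by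
  simp only [SimBy]
  refine MeasurableSet.inter ?_ ?_
  · exact measurableSet_le hf measurable_const
  · exact measurableSet_le measurable_const (hf.const_mul c)

theorem volume_closedBall_le [NeZero d] (y : EuclideanSpace ℝ (Fin d)) {r : ℝ} (hr : 0 ≤ r) :
    volume (Metric.closedBall y r) ≤ ENNReal.ofReal (2 ^ d * r ^ d) := by
  have h0 : (EuclideanSpace.single (0 : Fin d) (1 : ℝ)) ≠ 0 := by simp
  rw [Measure.addHaar_closedBall_center]
  refine (measure_mono (t := cyl (EuclideanSpace.single (0 : Fin d) (1 : ℝ)) r r) ?_).trans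
    ((volume_cyl_le h0 hr hr).trans (le_of_eq ?_))
  · intro x hx
    rw [mem_closedBall_zero_iff] at hx
    exact ⟨hx, (norm_perp_le _ _).trans hx⟩
  · rw [mul_pow_sub_one (NeZero.ne d)]

theorem volume_preimage_cyl_le [NeZero d] {u : EuclideanSpace ℝ (Fin d)} (hu : u ≠ 0)
    (y : EuclideanSpace ℝ (Fin d)) {r s : ℝ} (hr : 0 ≤ r) (hs : 0 ≤ s) :
    volume {x | x - y ∈ cyl u r s} ≤ ENNReal.ofReal (2 ^ d * (r * s ^ (d - 1))) := by
  refine le_trans (le_of_eq ?_) (volume_cyl_le hu hr hs)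
  simp only [sub_eq_add_neg]
  exact measure_preimage_add_right volume (-y) (cyl u r s)

/-- Points of a small ball far from the origin at which `|ξ| + |ξ + ζ|` lies in an interval:
this function increases at unit rate in the direction of the centre of the ball. -/
theorem volume_sum_slab_le [NeZero d] {A n m τ : ℝ} (hA : 1 ≤ A) (hn : 0 < n) (hm : 0 ≤ m)
    {ζ y : EuclideanSpace ℝ (Fin d)} (hζ : ‖ζ‖ ≤ A * n) :
    volume {ξ : EuclideanSpace ℝ (Fin d) | ‖y - ξ‖ ≤ n ∧ 8 * A * n ≤ ‖ξ‖ ∧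
      |τ + ‖ξ‖ + ‖ξ + ζ‖| ≤ m} ≤ ENNReal.ofReal (4 ^ d * 4 * (n ^ d * min 1 (m / n))) := by
  set S := {ξ : EuclideanSpace ℝ (Fin d) | ‖y - ξ‖ ≤ n ∧ 8 * A * n ≤ ‖ξ‖ ∧
      |τ + ‖ξ‖ + ‖ξ + ζ‖| ≤ m} with hS
  have hSm : MeasurableSet S := by
    rw [hS]
    refine measurableSet_and ?_ (measurableSet_and ?_ ?_) <;>
    apply measurableSet_le <;> fun_prop
  have hAn : n ≤ A * n := le_mul_of_one_le_left hn.le hA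
  have e2 : (4 : ℝ) ^ d = 2 ^ d * 2 ^ d := by rw [← mul_pow]; norm_num
  have h2d : (1 : ℝ) ≤ 2 ^ d := one_le_pow₀ (by norm_num)
  refine le_ofReal_mul_min ?_ ?_
  · refine (measure_mono (t := Metric.closedBall y n) ?_).trans
      ((volume_closedBall_le y hn.le).trans (ENNReal.ofReal_le_ofReal ?_))
    · intro ξ hξ
      rw [mem_closedBall_iff_norm, norm_sub_rev]; exact hξ.1
    · rw [e2]
      gcongr
      nlinarith
  · refine (volume_le_of_translate hSm (dir y) (l := 4 * m) (T := n) hn ?_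
      (D := Metric.closedBall y (2 * n)) ?_).trans ?_
    · intro ξ hξ t ht hξ'
      obtain ⟨h1, h2, h3⟩ := hξ
      obtain ⟨-, -, h6⟩ := hξ'
      have hy : ‖ξ‖ - n ≤ ‖y‖ := by
        have := norm_sub_norm_le ξ y
        rw [norm_sub_rev] at this; linarith
      have a0 : ‖ξ‖ - 2 * n ≤ ⟪ξ, dir y⟫ := by
        have e : ⟪ξ, dir y⟫ = ‖y‖ - ⟪y - ξ, dir y⟫ := by
          rw [inner_sub_left, real_inner_comm (dir y) y, inner_dir_self]; ring
        have := (real_inner_le_norm (y - ξ) (dir y)).trans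
          (mul_le_of_le_one_right (norm_nonneg _) (norm_dir_le y))
        linarith
      have b0 : 0 ≤ ⟪ξ + ζ, dir y⟫ := by
        rw [inner_add_left]
        have := neg_le_of_abs_le (abs_real_inner_le_norm ζ (dir y))
        have := mul_le_of_le_one_right (norm_nonneg ζ) (norm_dir_le y)
        linarith
      have hξ0 : 0 < ‖ξ‖ := by nlinarith
      have a1 : 1 / 2 ≤ ⟪dir ξ, dir y⟫ := by
        rw [dir, real_inner_smul_left, ← div_eq_inv_mul, le_div_iff₀ hξ0]
        linarith
      have b1 : 0 ≤ ⟪dir (ξ + ζ), dir y⟫ := by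
        rw [dir, real_inner_smul_left]; positivity
      have a2 := norm_add_ge ξ (t • dir y)
      have b2 := norm_add_ge (ξ + ζ) (t • dir y)
      rw [inner_smul_right] at a2 b2
      rw [show ξ + ζ + t • dir y = ξ + t • dir y + ζ by abel] at b2
      have := abs_le.1 h3
      have := abs_le.1 h6
      nlinarith [mul_nonneg ht b1, mul_le_mul_of_nonneg_left a1 ht]
    · intro x s hs hx
      rw [mem_closedBall_iff_norm]
      have : x - y = (x + s • dir y - y) - s • dir y := by abel
      rw [this]
      refine (norm_sub_le _ _).trans ?_
      have h1 : ‖s • dir y‖ ≤ n := by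
        rw [norm_smul, Real.norm_eq_abs, abs_of_nonneg hs.1]
        exact (mul_le_of_le_one_right hs.1 (norm_dir_le y)).trans hs.2
      have h2 := hx.1
      rw [norm_sub_rev] at h2
      linarith
    · refine (mul_le_mul_right (volume_closedBall_le y (by positivity)) _).trans ?_
      rw [← ENNReal.ofReal_mul (by positivity)]
      apply ENNReal.ofReal_le_ofReal
      rw [e2, mul_pow]
      apply le_of_eq
      ring

theorem norm_perp_le_of_mul_sq_le {V : Type*} [NormedAddCommGroup V] [InnerProductSpace ℝ V]
    {u x : V} {c : ℝ} (hu : 0 < ‖u‖) (hc : 0 ≤ c) (h : ‖u‖ * ‖perp u x‖ ^ 2 ≤ ‖u‖ * c ^ 2) :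
    ‖perp u x‖ ≤ c :=
  (sq_le_sq₀ (norm_nonneg _) hc).1 (le_of_mul_le_mul_left h hu)

/-- The possible second frequencies when the first one is fixed. They make an angle at most
`≈ (H / N₂)^{1/2}` with it, and along rays `|ξ| - |p + ξ|` increases at rate `≈ H / N₂`. The
condition `0 ≤ τ` excludes the degenerate case of almost antiparallel `p` and `p + ξ`, unless `m`
is comparable to `|p|`. -/
theorem volume_first_fixed_le [NeZero d] {A N₁ N₂ N₃ H ρ m τ : ℝ} (hA : 1 ≤ A) (hN₁ : 0 < N₁)
    (hN₂ : 0 < N₂) (hH : 0 < H) (hρ : 0 < ρ) (hρ2 : ρ ^ 2 = N₂ * H) (hm : 0 ≤ m) (hτ : 0 ≤ τ)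
    (h31 : N₃ ≤ A * N₁) (h21 : N₂ ≤ A * N₁) (hH2 : H ≤ A * N₂)
    {p : EuclideanSpace ℝ (Fin d)} (hp : SimBy A ‖p‖ N₁) :
    volume {ξ : EuclideanSpace ℝ (Fin d) | SimBy A ‖ξ‖ N₂ ∧ SimBy A ‖p + ξ‖ N₃ ∧
      SimBy A (‖p‖ + ‖ξ‖ - ‖p + ξ‖) H ∧ |τ + ‖ξ‖ - ‖p + ξ‖| ≤ m} ≤
      ENNReal.ofReal (2 ^ d * 16 * A ^ 6 * (2 ^ d * A * (2 * A ^ 3) ^ (d - 1)) *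
        (N₂ * ρ ^ (d - 1) * min 1 (m / H))) := by
  set S := {ξ : EuclideanSpace ℝ (Fin d) | SimBy A ‖ξ‖ N₂ ∧ SimBy A ‖p + ξ‖ N₃ ∧
      SimBy A (‖p‖ + ‖ξ‖ - ‖p + ξ‖) H ∧ |τ + ‖ξ‖ - ‖p + ξ‖| ≤ m} with hS
  have hSm : MeasurableSet S := by
    rw [hS]
    refine measurableSet_and ?_ (measurableSet_and ?_ (measurableSet_and ?_ ?_))
    · exact measurableSet_simBy (by fun_prop) _ _
    · exact measurableSet_simBy (by fun_prop) _ _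
    · exact measurableSet_simBy (by fun_prop) _ _
    · apply measurableSet_le <;> fun_prop
  have hA0 : 0 < A := by linarith
  have hp0 : 0 < ‖p‖ := by
    by_contra h
    have : ‖p‖ = 0 := le_antisymm (not_lt.1 h) (norm_nonneg _)
    have := hp.2
    simp_all
    linarith
  have hpne : p ≠ 0 := norm_pos_iff.1 hp0
  have hN1p : N₁ ≤ A * ‖p‖ := hp.2
  have hξp : ∀ ξ ∈ S, ‖ξ‖ ≤ A ^ 3 * ‖p‖ := by
    intro ξ hξ
    calc ‖ξ‖ ≤ A * N₂ := hξ.1.1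
      _ ≤ A * (A * (A * ‖p‖)) := by gcongr; exact h21.trans (by gcongr)
      _ = _ := by ring
  have hA3 : 1 ≤ A ^ 3 := one_le_pow₀ hA
  have hcyl : ∀ ξ ∈ S, ‖ξ‖ ≤ A * N₂ ∧ ‖perp p ξ‖ ≤ 2 * A ^ 3 * ρ := by
    intro ξ hξ
    obtain ⟨h1, h2, h3, h4⟩ := id hξ
    refine ⟨h1.1, norm_perp_le_of_mul_sq_le hp0 (by positivity) ?_⟩
    have e := norm_mul_norm_perp_sq_le p ξ
    have e2 := two_mul_norm_mul_sub_inner p ξ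
    have hsum : ‖p‖ + ‖ξ‖ + ‖p + ξ‖ ≤ 4 * A ^ 3 * ‖p‖ := by
      have := norm_add_le p ξ
      have := hξp ξ hξ
      nlinarith
    calc ‖p‖ * ‖perp p ξ‖ ^ 2 ≤ ‖ξ‖ * ((‖p‖ + ‖ξ‖ - ‖p + ξ‖) * (‖p‖ + ‖ξ‖ + ‖p + ξ‖)) := by
          rw [← e2]; linarith
      _ ≤ (A * N₂) * ((A * H) * (4 * A ^ 3 * ‖p‖)) := by
          have h0 : 0 ≤ ‖p‖ + ‖ξ‖ - ‖p + ξ‖ := by linarith [norm_add_le p ξ]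
          have h5 : ‖p‖ + ‖ξ‖ - ‖p + ξ‖ ≤ A * H := h3.1
          have h6 : ‖ξ‖ ≤ A * N₂ := h1.1
          gcongr
      _ = ‖p‖ * (4 * A ^ 5 * (N₂ * H)) := by ring
      _ ≤ ‖p‖ * (4 * A ^ 6 * (N₂ * H)) := by gcongr ; norm_num [hA]
      _ = ‖p‖ * (2 * A ^ 3 * ρ) ^ 2 := by rw [mul_pow, hρ2]; ring
  have hκ : 1 ≤ 2 ^ d * 16 * A ^ 6 := by
    have : (1 : ℝ) ≤ 2 ^ d := one_le_pow₀ (by norm_num)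
    have : 1 ≤ A ^ 6 := one_le_pow₀ hA
    nlinarith
  have hdisc : volume (cyl p (A * N₂) (2 * A ^ 3 * ρ)) ≤
      ENNReal.ofReal ((2 ^ d * A * (2 * A ^ 3) ^ (d - 1)) * (N₂ * ρ ^ (d - 1))) := by
    refine (volume_cyl_le hpne (by positivity) (by positivity)).trans (le_of_eq ?_)
    rw [mul_pow _ ρ]
    congr 1; ring
  have hvol : volume S ≤
      ENNReal.ofReal ((2 ^ d * A * (2 * A ^ 3) ^ (d - 1)) * (N₂ * ρ ^ (d - 1))) :=
    (measure_mono hcyl).trans hdisc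
  refine le_ofReal_mul_min (hvol.trans (ENNReal.ofReal_le_ofReal ?_)) ?_
  · rw [mul_assoc (2 ^ d * 16 * A ^ 6)]
    exact le_mul_of_one_le_left (by positivity) hκ
  rcases le_total (‖p‖ / 4) m with hmp | hmp
  · refine hvol.trans (ENNReal.ofReal_le_ofReal ?_)
    have : 1 ≤ 2 ^ d * 16 * A ^ 6 * (m / H) := by
      rw [← mul_div_assoc, one_le_div hH]
      have h1 : (1 : ℝ) ≤ 2 ^ d := one_le_pow₀ (by norm_num)
      calc H ≤ A * (A * (A * ‖p‖)) := by
            refine hH2.trans ?_; gcongr; exact h21.trans (by gcongr)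
        _ = A ^ 3 * ‖p‖ := by ring
        _ ≤ A ^ 6 * ‖p‖ := by gcongr ; norm_num [hA]
        _ ≤ A ^ 6 * (4 * m) := by gcongr; linarith
        _ ≤ 2 ^ d * 16 * A ^ 6 * m := by nlinarith [show 0 ≤ A ^ 6 * m by positivity]
    calc _ ≤ (2 ^ d * 16 * A ^ 6 * (m / H)) *
        ((2 ^ d * A * (2 * A ^ 3) ^ (d - 1)) * (N₂ * ρ ^ (d - 1))) :=
          le_mul_of_one_le_left (by positivity) this
      _ = _ := by ring
  · refine (volume_le_of_dilate hSm (l := 8 * A ^ 6 * m / H)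
      (D := cyl p (A * N₂) (2 * A ^ 3 * ρ)) ?_ ?_).trans ?_
    · intro ξ hξ μ hμ hη
      obtain ⟨h1, h2, h3, h4⟩ := hξ
      set η := μ • ξ with hηdef
      obtain ⟨k1, k2, k3, k4⟩ := hη
      have hμ0 : 0 < μ := by linarith
      have hnη : ‖η‖ = μ * ‖ξ‖ := by rw [hηdef, norm_smul, Real.norm_eq_abs, abs_of_pos hμ0]
      have hξ0 : 0 < ‖ξ‖ := by have := h1.2; nlinarith
      have hμA : μ ≤ A ^ 2 := by
        have : μ * ‖ξ‖ ≤ A ^ 2 * ‖ξ‖ := by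
          rw [← hnη]
          calc ‖η‖ ≤ A * N₂ := k1.1
            _ ≤ A * (A * ‖ξ‖) := by gcongr; exact h1.2
            _ = _ := by ring
        exact le_of_mul_le_mul_right this hξ0
      have hdiff : (μ - 1) * (‖ξ‖ - ⟪dir (p + η), ξ⟫) ≤ 2 * m := by
        have := norm_add_ge (p + η) (-((μ - 1) • ξ))
        rw [inner_neg_right, inner_smul_right,
          show p + η + -((μ - 1) • ξ) = p + ξ by rw [hηdef, sub_smul, one_smul]; abel] at this
        have := abs_le.1 h4
        have := abs_le.1 k4
        nlinarith
      have hq0 : 0 < ‖p + η‖ := by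
        by_contra h
        have h0 : ‖p + η‖ = 0 := le_antisymm (not_lt.1 h) (norm_nonneg _)
        have h5 : ‖p‖ ≤ ‖η‖ := by
          have := norm_sub_norm_le p (-η)
          rw [norm_neg, sub_neg_eq_add, h0] at this; linarith
        have := (abs_le.1 k4).2
        linarith
      have hres := two_mul_norm_mul_add_sub_inner p η
      have hlow : H / (4 * A ^ 4) ≤ ‖η‖ - ⟪dir (p + η), η⟫ := by
        have e : ‖p + η‖ * (‖η‖ - ⟪dir (p + η), η⟫) = ‖η‖ * ‖p + η‖ - ⟪η, p + η⟫ := by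
          rw [dir, real_inner_smul_left, mul_sub, mul_inv_cancel_left₀ hq0.ne', mul_comm,
            real_inner_comm]
        have hq : ‖p + η‖ ≤ A ^ 3 * ‖p‖ := by
          calc ‖p + η‖ ≤ A * N₃ := k2.1
            _ ≤ A * (A * (A * ‖p‖)) := by gcongr; exact h31.trans (by gcongr)
            _ = _ := by ring
        have hh : ‖p‖ + ‖η‖ - ‖p + η‖ ≤ 5 / 4 * ‖p‖ := by
          have := (abs_le.1 k4).2
          linarith
        have hh2 : H ≤ A * (‖p‖ + ‖η‖ - ‖p + η‖) := k3.2
        have h3 : H * ‖p‖ ≤ A * (4 * (‖η‖ * ‖p + η‖ - ⟪η, p + η⟫)) := by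
          have h0 : 0 ≤ ‖p‖ + ‖η‖ - ‖p + η‖ := by linarith [norm_add_le p η]
          have : H * ‖p‖ ≤ A * (‖p‖ + ‖η‖ - ‖p + η‖) * ‖p‖ := by gcongr
          have h7 : (‖p‖ + ‖η‖ - ‖p + η‖) * ‖p‖ ≤ 4 * (‖η‖ * ‖p + η‖ - ⟪η, p + η⟫) := by
            nlinarith
          calc _ ≤ A * ((‖p‖ + ‖η‖ - ‖p + η‖) * ‖p‖) := by linarith
            _ ≤ _ := by gcongr
        have hpos : 0 ≤ ‖η‖ - ⟪dir (p + η), η⟫ :=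
          sub_nonneg.2 ((real_inner_le_norm _ _).trans
            (mul_le_of_le_one_left (norm_nonneg _) (norm_dir_le _)))
        rw [div_le_iff₀ (by positivity)]
        refine le_of_mul_le_mul_right ?_ hp0
        calc H * ‖p‖ ≤ A * (4 * (‖p + η‖ * (‖η‖ - ⟪dir (p + η), η⟫))) := by rw [e]; exact h3
          _ ≤ A * (4 * ((A ^ 3 * ‖p‖) * (‖η‖ - ⟪dir (p + η), η⟫))) := by gcongr
          _ = _ := by ring
      have e3 : ‖η‖ - ⟪dir (p + η), η⟫ = μ * (‖ξ‖ - ⟪dir (p + η), ξ⟫) := by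
        rw [hnη]; nth_rewrite 2 [hηdef]; rw [inner_smul_right]; ring
      have hμ1 : 0 ≤ μ - 1 := by linarith
      have hfin : (μ - 1) * (H / (4 * A ^ 4)) ≤ A ^ 2 * (2 * m) := by
        calc (μ - 1) * (H / (4 * A ^ 4)) ≤ (μ - 1) * (μ * (‖ξ‖ - ⟪dir (p + η), ξ⟫)) := by
              rw [← e3]; gcongr
          _ = μ * ((μ - 1) * (‖ξ‖ - ⟪dir (p + η), ξ⟫)) := by ring
          _ ≤ μ * (2 * m) := by gcongr
          _ ≤ A ^ 2 * (2 * m) := by gcongr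
      rw [← mul_div_assoc, div_le_iff₀ (by positivity)] at hfin
      rw [le_div_iff₀ hH]
      calc _ ≤ _ := hfin
        _ = _ := by ring
    · intro x s hs hx
      have hs0 : 0 < s := by linarith [hs.1]
      obtain ⟨h1, h2⟩ := hcyl _ hx
      rw [norm_smul, Real.norm_eq_abs, abs_of_pos hs0] at h1
      rw [perp_smul, norm_smul, Real.norm_eq_abs, abs_of_pos hs0] at h2
      exact ⟨(le_mul_of_one_le_left (norm_nonneg _) hs.1).trans h1,
        (le_mul_of_one_le_left (norm_nonneg _) hs.1).trans h2⟩
    · refine (mul_le_mul_right hdisc _).trans ?_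
      rw [← ENNReal.ofReal_mul (by positivity)]
      apply ENNReal.ofReal_le_ofReal
      apply le_of_eq
      ring

/-- The possible second frequencies when the sum `ζ` of the first two is fixed. They make an angle
at most `≈ (H / N₂)^{1/2}` with it, and along rays `|ξ| + |ζ - ξ|` increases at rate `≈ H / N₂`. -/
theorem volume_third_fixed_le [NeZero d] {A N₁ N₂ N₃ H ρ m τ : ℝ} (hA : 1 ≤ A) (hN₁ : 0 < N₁)
    (hN₂ : 0 < N₂) (hH : 0 < H) (hρ : 0 < ρ) (hρ2 : ρ ^ 2 = N₂ * H) (hm : 0 ≤ m)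
    (h13 : N₁ ≤ A * N₃)
    {ζ : EuclideanSpace ℝ (Fin d)} (hζ : SimBy A ‖ζ‖ N₃) :
    volume {ξ : EuclideanSpace ℝ (Fin d) | SimBy A ‖ξ‖ N₂ ∧ SimBy A ‖ζ - ξ‖ N₁ ∧
      SimBy A (‖ζ - ξ‖ + ‖ξ‖ - ‖ζ‖) H ∧ |τ + ‖ξ‖ + ‖ζ - ξ‖| ≤ m} ≤
      ENNReal.ofReal (2 ^ d * 16 * A ^ 6 * (2 ^ d * A * (2 * A ^ 3) ^ (d - 1)) *
        (N₂ * ρ ^ (d - 1) * min 1 (m / H))) := by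
  set S := {ξ : EuclideanSpace ℝ (Fin d) | SimBy A ‖ξ‖ N₂ ∧ SimBy A ‖ζ - ξ‖ N₁ ∧
      SimBy A (‖ζ - ξ‖ + ‖ξ‖ - ‖ζ‖) H ∧ |τ + ‖ξ‖ + ‖ζ - ξ‖| ≤ m} with hS
  have hSm : MeasurableSet S := by
    rw [hS]
    refine measurableSet_and ?_ (measurableSet_and ?_ (measurableSet_and ?_ ?_))
    · exact measurableSet_simBy (by fun_prop) _ _
    · exact measurableSet_simBy (by fun_prop) _ _
    · exact measurableSet_simBy (by fun_prop) _ _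
    · apply measurableSet_le <;> fun_prop
  have hA0 : 0 < A := by linarith
  have hN1ζ : N₁ ≤ A ^ 2 * ‖ζ‖ := by
    calc N₁ ≤ A * (A * ‖ζ‖) := h13.trans (by gcongr; exact hζ.2)
      _ = _ := by ring
  have hζ0 : 0 < ‖ζ‖ := by
    by_contra h
    have : ‖ζ‖ = 0 := le_antisymm (not_lt.1 h) (norm_nonneg _)
    rw [this] at hN1ζ
    linarith
  have hζne : ζ ≠ 0 := norm_pos_iff.1 hζ0
  have hcyl : ∀ ξ ∈ S, ‖ξ‖ ≤ A * N₂ ∧ ‖perp ζ ξ‖ ≤ 2 * A ^ 3 * ρ := by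
    intro ξ hξ
    obtain ⟨h1, h2, h3, h4⟩ := id hξ
    refine ⟨h1.1, norm_perp_le_of_mul_sq_le hζ0 (by positivity) ?_⟩
    have e := norm_mul_norm_perp_sq_le ζ ξ
    have e2 := two_mul_norm_mul_add_sub_inner (ζ - ξ) ξ
    rw [sub_add_cancel] at e2
    have h0 : 0 ≤ ‖ζ - ξ‖ + ‖ξ‖ - ‖ζ‖ := by
      have := norm_add_le (ζ - ξ) ξ
      rw [sub_add_cancel] at this; linarith
    have hA5 : A ^ 4 * A ≤ A ^ 6 := by
      rw [← pow_succ]; exact pow_le_pow_right₀ hA (by norm_num)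
    calc ‖ζ‖ * ‖perp ζ ξ‖ ^ 2 ≤ ‖ξ‖ * ((‖ζ - ξ‖ + ‖ξ‖ - ‖ζ‖) * (2 * ‖ζ - ξ‖ -
          (‖ζ - ξ‖ + ‖ξ‖ - ‖ζ‖))) := by
          rw [← e2, real_inner_comm ζ ξ, mul_comm ‖ξ‖ ‖ζ‖]; linarith
      _ ≤ (A * N₂) * ((A * H) * (2 * (A * (A ^ 2 * ‖ζ‖)))) := by
          have : ‖ζ - ξ‖ ≤ A * (A ^ 2 * ‖ζ‖) := h2.1.trans (by gcongr)
          have hx : 2 * ‖ζ - ξ‖ - (‖ζ - ξ‖ + ‖ξ‖ - ‖ζ‖) ≤ 2 * (A * (A ^ 2 * ‖ζ‖)) := by linarith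
          have h5 : (‖ζ - ξ‖ + ‖ξ‖ - ‖ζ‖) * (2 * ‖ζ - ξ‖ - (‖ζ - ξ‖ + ‖ξ‖ - ‖ζ‖)) ≤
            (A * H) * (2 * (A * (A ^ 2 * ‖ζ‖))) :=
            (mul_le_mul_of_nonneg_left hx h0).trans
              (mul_le_mul_of_nonneg_right h3.1 (by positivity))
          exact (mul_le_mul_of_nonneg_left h5 (norm_nonneg _)).trans
            (mul_le_mul_of_nonneg_right h1.1 (by positivity))
      _ = ‖ζ‖ * (2 * (A ^ 4 * A) * (N₂ * H)) := by ring
      _ ≤ ‖ζ‖ * (2 * A ^ 6 * (N₂ * H)) := by gcongr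
      _ ≤ ‖ζ‖ * (4 * A ^ 6 * (N₂ * H)) := by gcongr; norm_num
      _ = ‖ζ‖ * (2 * A ^ 3 * ρ) ^ 2 := by rw [mul_pow, hρ2]; ring
  have hA6 : 1 ≤ A ^ 6 := one_le_pow₀ hA
  have h2d : (1 : ℝ) ≤ 2 ^ d := one_le_pow₀ (by norm_num)
  have hdisc : volume (cyl ζ (A * N₂) (2 * A ^ 3 * ρ)) ≤
      ENNReal.ofReal ((2 ^ d * A * (2 * A ^ 3) ^ (d - 1)) * (N₂ * ρ ^ (d - 1))) := by
    refine (volume_cyl_le hζne (by positivity) (by positivity)).trans (le_of_eq ?_)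
    rw [mul_pow _ ρ]
    congr 1; ring
  refine le_ofReal_mul_min (((measure_mono hcyl).trans hdisc).trans
    (ENNReal.ofReal_le_ofReal ?_)) ?_
  · rw [mul_assoc (2 ^ d * 16 * A ^ 6)]
    refine le_mul_of_one_le_left (by positivity) ?_
    nlinarith
  refine (volume_le_of_dilate hSm (l := 4 * A * m / H)
      (D := cyl ζ (A * N₂) (2 * A ^ 3 * ρ)) ?_ ?_).trans ?_
  · intro ξ hξ μ hμ hη
    obtain ⟨h1, h2, h3, h4⟩ := hξ
    have hμ0 : 0 < μ := by linarith
    have k4 := hη.2.2.2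
    rw [norm_smul, Real.norm_eq_abs, abs_of_pos hμ0] at k4
    have hx0 : 0 < ‖ζ - ξ‖ := by have := h2.2; nlinarith
    have hdiff : (μ - 1) * (‖ξ‖ - ⟪dir (ζ - ξ), ξ⟫) ≤ 2 * m := by
      have := norm_add_ge (ζ - ξ) (-((μ - 1) • ξ))
      rw [inner_neg_right, inner_smul_right,
        show ζ - ξ + -((μ - 1) • ξ) = ζ - μ • ξ by rw [sub_smul, one_smul]; abel] at this
      have := abs_le.1 h4
      have := abs_le.1 k4
      nlinarith
    have hlow : H / (2 * A) ≤ ‖ξ‖ - ⟪dir (ζ - ξ), ξ⟫ := by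
      have e : ‖ζ - ξ‖ * (‖ξ‖ - ⟪dir (ζ - ξ), ξ⟫) = ‖ζ - ξ‖ * ‖ξ‖ - ⟪ζ - ξ, ξ⟫ := by
        rw [dir, real_inner_smul_left, mul_sub, mul_inv_cancel_left₀ hx0.ne']
      have hres := two_mul_norm_mul_sub_inner (ζ - ξ) ξ
      rw [sub_add_cancel] at hres
      have hh2 : H ≤ A * (‖ζ - ξ‖ + ‖ξ‖ - ‖ζ‖) := h3.2
      have h0 : 0 ≤ ‖ζ - ξ‖ + ‖ξ‖ - ‖ζ‖ := by nlinarith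
      rw [div_le_iff₀ (by positivity)]
      refine le_of_mul_le_mul_left ?_ hx0
      calc ‖ζ - ξ‖ * H ≤ ‖ζ - ξ‖ * (A * (‖ζ - ξ‖ + ‖ξ‖ - ‖ζ‖)) := by gcongr
        _ = A * ((‖ζ - ξ‖ + ‖ξ‖ - ‖ζ‖) * ‖ζ - ξ‖) := by ring
        _ ≤ A * ((‖ζ - ξ‖ + ‖ξ‖ - ‖ζ‖) * (‖ζ - ξ‖ + ‖ξ‖ + ‖ζ‖)) := by
            gcongr
            linarith [norm_nonneg ξ, norm_nonneg ζ]
        _ = A * (2 * (‖ζ - ξ‖ * (‖ξ‖ - ⟪dir (ζ - ξ), ξ⟫))) := by rw [e, hres]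
        _ = _ := by ring
    have hfin := (mul_le_mul_of_nonneg_left hlow (sub_nonneg.2 hμ)).trans hdiff
    rw [← mul_div_assoc, div_le_iff₀ (by positivity)] at hfin
    rw [le_div_iff₀ hH]
    linarith
  · intro x s hs hx
    have hs0 : 0 < s := by linarith [hs.1]
    obtain ⟨h1, h2⟩ := hcyl _ hx
    rw [norm_smul, Real.norm_eq_abs, abs_of_pos hs0] at h1
    rw [perp_smul, norm_smul, Real.norm_eq_abs, abs_of_pos hs0] at h2
    exact ⟨(le_mul_of_one_le_left (norm_nonneg _) hs.1).trans h1,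
      (le_mul_of_one_le_left (norm_nonneg _) hs.1).trans h2⟩
  · refine (mul_le_mul_right hdisc _).trans ?_
    rw [← ENNReal.ofReal_mul (by positivity)]
    apply ENNReal.ofReal_le_ofReal
    have : 8 * A ≤ 16 * A ^ 6 := by
      have : A ≤ A ^ 6 := le_self_pow₀ hA (by norm_num)
      linarith
    calc _ = 2 ^ d * (8 * A) * (2 ^ d * A * (2 * A ^ 3) ^ (d - 1)) *
          (N₂ * ρ ^ (d - 1) * (m / H)) := by ring
      _ ≤ 2 ^ d * (16 * A ^ 6) * (2 ^ d * A * (2 * A ^ 3) ^ (d - 1)) *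
          (N₂ * ρ ^ (d - 1) * (m / H)) := by gcongr
      _ = _ := by ring

end SpatialSets

/-! ### Angles between the frequencies -/

section Directions
variable {V : Type*} [NormedAddCommGroup V] [InnerProductSpace ℝ V]

/-- The angle between the first frequency and minus the third is at most `≈ ρ / N₁`. -/
theorem norm_dir_sub_dir_add_le {A N₁ N₂ N₃ H ρ : ℝ} (hA : 1 ≤ A) (hN₁ : 0 < N₁)
    (hN₂ : 0 < N₂) (hH : 0 < H) (hρ : 0 < ρ) (hρ2 : ρ ^ 2 = N₂ * H) (h13 : N₁ ≤ A * N₃)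
    {p ξ : V} (hp : SimBy A ‖p‖ N₂) (h1 : SimBy A ‖ξ‖ N₁) (h3 : SimBy A ‖ξ + p‖ N₃)
    (hh : SimBy A (‖ξ‖ + ‖p‖ - ‖ξ + p‖) H) :
    ‖dir ξ - dir (ξ + p)‖ * N₁ ≤ 2 * A ^ 3 * ρ := by
  have hA0 : 0 < A := by linarith
  have hNξ : N₁ ≤ A * ‖ξ‖ := h1.2
  have hNη : N₁ ≤ A ^ 2 * ‖ξ + p‖ := by
    calc N₁ ≤ A * (A * ‖ξ + p‖) := h13.trans (by gcongr; exact h3.2)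
      _ = _ := by ring
  have hξ0 : 0 < ‖ξ‖ := by nlinarith [norm_nonneg ξ]
  have hη0 : 0 < ‖ξ + p‖ := pos_of_mul_pos_right (hN₁.trans_le hNη) (by positivity)
  have e := norm_dir_sub_dir_sq (norm_pos_iff.1 hξ0) (norm_pos_iff.1 hη0)
  have e2 := two_mul_norm_mul_add_sub_inner p ξ
  rw [add_comm p ξ] at e2
  rw [e2] at e
  have h0 : 0 ≤ ‖p‖ + ‖ξ‖ - ‖ξ + p‖ := by linarith [norm_add_le ξ p]
  refine (sq_le_sq₀ (by positivity) (by positivity)).1 ?_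
  have hA5 : A ^ 5 ≤ A ^ 6 := pow_le_pow_right₀ hA (by norm_num)
  have hpn : ‖p‖ ≤ A * N₂ := hp.1
  have hhn : ‖p‖ + ‖ξ‖ - ‖ξ + p‖ ≤ A * H := by linarith [hh.1]
  calc (‖dir ξ - dir (ξ + p)‖ * N₁) ^ 2 = ‖dir ξ - dir (ξ + p)‖ ^ 2 * (N₁ * N₁) := by ring
    _ ≤ ‖dir ξ - dir (ξ + p)‖ ^ 2 * ((A * ‖ξ‖) * (A ^ 2 * ‖ξ + p‖)) := by gcongr
    _ = A ^ 3 * (‖dir ξ - dir (ξ + p)‖ ^ 2 * (‖ξ‖ * ‖ξ + p‖)) := by ring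
    _ = A ^ 3 * ((‖p‖ + ‖ξ‖ - ‖ξ + p‖) * (2 * ‖p‖ - (‖p‖ + ‖ξ‖ - ‖ξ + p‖))) := by rw [e]
    _ ≤ A ^ 3 * ((‖p‖ + ‖ξ‖ - ‖ξ + p‖) * (2 * ‖p‖)) := by gcongr; linarith
    _ ≤ A ^ 3 * ((A * H) * (2 * (A * N₂))) := by gcongr
    _ = 2 * A ^ 5 * (N₂ * H) := by ring
    _ ≤ 4 * A ^ 6 * (N₂ * H) := by gcongr; norm_num
    _ = _ := by rw [mul_pow, hρ2]; ring

/-- The angle between the first frequency and minus the third is at least `≈ ρ / N₁`, away from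
the degenerate case where `h` is close to `2 |ξ₂|`. -/
theorem le_norm_dir_sub_dir_add {A N₁ N₂ N₃ H ρ : ℝ} (hA : 1 ≤ A) (hN₁ : 0 < N₁)
    (hH : 0 < H) (hρ : 0 < ρ) (hρ2 : ρ ^ 2 = N₂ * H) (h31 : N₃ ≤ A * N₁)
    {p ξ : V} (hp : SimBy A ‖p‖ N₂) (h1 : SimBy A ‖ξ‖ N₁) (h3 : SimBy A ‖ξ + p‖ N₃)
    (hh : SimBy A (‖ξ‖ + ‖p‖ - ‖ξ + p‖) H) (hξ0 : 0 < ‖ξ‖) (hη0 : 0 < ‖ξ + p‖)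
    (hd : ‖ξ‖ + ‖p‖ - ‖ξ + p‖ ≤ 5 / 4 * ‖p‖) :
    ρ ≤ 2 * A ^ 3 * (‖dir ξ - dir (ξ + p)‖ * N₁) := by
  have hA0 : 0 < A := by linarith
  have e := norm_dir_sub_dir_sq (norm_pos_iff.1 hξ0) (norm_pos_iff.1 hη0)
  have e2 := two_mul_norm_mul_add_sub_inner p ξ
  rw [add_comm p ξ] at e2
  rw [e2] at e
  have h0 : 0 ≤ ‖p‖ + ‖ξ‖ - ‖ξ + p‖ := by linarith [norm_add_le ξ p]
  refine (sq_le_sq₀ (by positivity) (by positivity)).1 ?_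
  have hA5 : A ^ 5 ≤ A ^ 6 := pow_le_pow_right₀ hA (by norm_num)
  have hpn : N₂ ≤ A * ‖p‖ := hp.2
  have hhn : H ≤ A * (‖p‖ + ‖ξ‖ - ‖ξ + p‖) := by linarith [hh.2]
  have hξn : ‖ξ‖ ≤ A * N₁ := h1.1
  have hηn : ‖ξ + p‖ ≤ A * (A * N₁) := h3.1.trans (by gcongr)
  calc ρ ^ 2 = N₂ * H := hρ2
    _ ≤ (A * ‖p‖) * (A * (‖p‖ + ‖ξ‖ - ‖ξ + p‖)) := by gcongr
    _ = A ^ 2 * ((‖p‖ + ‖ξ‖ - ‖ξ + p‖) * ‖p‖) := by ring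
    _ ≤ A ^ 2 * ((‖p‖ + ‖ξ‖ - ‖ξ + p‖) * (4 * (2 * ‖p‖ - (‖p‖ + ‖ξ‖ - ‖ξ + p‖)))) := by
        gcongr; linarith
    _ = 4 * A ^ 2 * (‖dir ξ - dir (ξ + p)‖ ^ 2 * (‖ξ‖ * ‖ξ + p‖)) := by rw [e]; ring
    _ ≤ 4 * A ^ 2 * (‖dir ξ - dir (ξ + p)‖ ^ 2 * ((A * N₁) * (A * (A * N₁)))) := by gcongr
    _ = 4 * A ^ 5 * (‖dir ξ - dir (ξ + p)‖ * N₁) ^ 2 := by ring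
    _ ≤ 4 * A ^ 6 * (‖dir ξ - dir (ξ + p)‖ * N₁) ^ 2 := by gcongr
    _ = _ := by ring

/-- The component of the second frequency orthogonal to the third is at most `≈ ρ`. -/
theorem norm_perp_add_le {A N₁ N₂ N₃ H ρ : ℝ} (hA : 1 ≤ A) (hN₁ : 0 < N₁)
    (hN₂ : 0 < N₂) (hH : 0 < H) (hρ : 0 < ρ) (hρ2 : ρ ^ 2 = N₂ * H) (h13 : N₁ ≤ A * N₃)
    {p ξ : V} (hp : SimBy A ‖p‖ N₂) (h1 : SimBy A ‖ξ‖ N₁) (h3 : SimBy A ‖ξ + p‖ N₃)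
    (hh : SimBy A (‖ξ‖ + ‖p‖ - ‖ξ + p‖) H) :
    ‖perp (ξ + p) p‖ ≤ 2 * A ^ 3 * ρ := by
  have hA0 : 0 < A := by linarith
  have hNη : N₁ ≤ A ^ 2 * ‖ξ + p‖ := by
    calc N₁ ≤ A * (A * ‖ξ + p‖) := h13.trans (by gcongr; exact h3.2)
      _ = _ := by ring
  have hη0 : 0 < ‖ξ + p‖ := pos_of_mul_pos_right (hN₁.trans_le hNη) (by positivity)
  refine norm_perp_le_of_mul_sq_le hη0 (by positivity) ?_
  have e := norm_mul_norm_perp_sq_le (ξ + p) p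
  have e2 := two_mul_norm_mul_add_sub_inner ξ p
  have h0 : 0 ≤ ‖ξ‖ + ‖p‖ - ‖ξ + p‖ := by linarith [norm_add_le ξ p]
  have hA5 : A ^ 5 ≤ A ^ 6 := pow_le_pow_right₀ hA (by norm_num)
  have hpn : ‖p‖ ≤ A * N₂ := hp.1
  have hhn : ‖ξ‖ + ‖p‖ - ‖ξ + p‖ ≤ A * H := hh.1
  have hξn : ‖ξ‖ ≤ A * (A ^ 2 * ‖ξ + p‖) := h1.1.trans (by gcongr)
  calc ‖ξ + p‖ * ‖perp (ξ + p) p‖ ^ 2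
      ≤ ‖p‖ * ((‖ξ‖ + ‖p‖ - ‖ξ + p‖) * (2 * ‖ξ‖ - (‖ξ‖ + ‖p‖ - ‖ξ + p‖))) := by
        rw [← e2, real_inner_comm (ξ + p) p, mul_comm ‖p‖ ‖ξ + p‖]; linarith
    _ ≤ ‖p‖ * ((‖ξ‖ + ‖p‖ - ‖ξ + p‖) * (2 * ‖ξ‖)) := by gcongr; linarith
    _ ≤ (A * N₂) * ((A * H) * (2 * (A * (A ^ 2 * ‖ξ + p‖)))) := by gcongr
    _ = ‖ξ + p‖ * (2 * A ^ 5 * (N₂ * H)) := by ring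
    _ ≤ ‖ξ + p‖ * (4 * A ^ 6 * (N₂ * H)) := by gcongr; norm_num
    _ = ‖ξ + p‖ * (2 * A ^ 3 * ρ) ^ 2 := by rw [mul_pow, hρ2]; ring

/-- If `y` is closer to `ξ` than half of `|ξ|`, then the angle between them is controlled by the
component of `y - ξ` orthogonal to `ξ`. -/
theorem norm_dir_sub_dir_mul_norm_le {ξ y : V} (hξ : 0 < ‖ξ‖) (h : ‖y - ξ‖ ≤ ‖ξ‖ / 2) :
    0 < ‖y‖ ∧ ‖dir ξ - dir y‖ * ‖ξ‖ ≤ 4 * ‖perp ξ (y - ξ)‖ := by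
  have hy : ‖ξ‖ / 2 ≤ ‖y‖ := by
    have := norm_sub_norm_le ξ y
    rw [norm_sub_rev] at this; linarith
  have hy0 : 0 < ‖y‖ := by linarith
  refine ⟨hy0, ?_⟩
  have hin : 0 ≤ ⟪ξ, y⟫ := by
    have e : ⟪ξ, y⟫ = ‖ξ‖ ^ 2 + ⟪ξ, y - ξ⟫ := by
      rw [inner_sub_right, real_inner_self_eq_norm_sq]; ring
    have := neg_le_of_abs_le (abs_real_inner_le_norm ξ (y - ξ))
    nlinarith
  have := norm_dir_sub_dir_mul_le (norm_pos_iff.1 hξ) (norm_pos_iff.1 hy0) hin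
  rw [perp_sub, perp_self, sub_zero]
  nlinarith [norm_nonneg (dir ξ - dir y)]

end Directions

/-! ### Localised sets of spatial frequencies -/

section LocalizedSpatialSet
variable {d : ℕ}

/-- The possible first frequencies when the second one is fixed, localised to a cylinder of length
`≈ N₂` and radius `≈ ρ`. The gradient of `|ξ + p| - |ξ|` is the difference of the directions of
`ξ + p` and `ξ`: it has size `≈ ρ / N₁` and, because of the small factor `a` in the
size of the cylinder, is almost constant there. -/
theorem volume_second_fixed_le [NeZero d] {A N₁ N₂ N₃ H ρ m τ a : ℝ} (hA : 1 ≤ A) (hN₁ : 0 < N₁)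
    (hN₂ : 0 < N₂) (hH : 0 < H) (hρ : 0 < ρ) (hρ2 : ρ ^ 2 = N₂ * H) (hm : 0 ≤ m) (hτ : 0 ≤ τ)
    (h13 : N₁ ≤ A * N₃) (h31 : N₃ ≤ A * N₁) (h21 : N₂ ≤ A * N₁) (hH2 : H ≤ A * N₂)
    (ha : a = 1 / (128 * A ^ 9))
    {p y : EuclideanSpace ℝ (Fin d)} (hp : SimBy A ‖p‖ N₂) :
    volume {ξ : EuclideanSpace ℝ (Fin d) | SimBy A ‖ξ‖ N₁ ∧ SimBy A ‖ξ + p‖ N₃ ∧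
      SimBy A (‖ξ‖ + ‖p‖ - ‖ξ + p‖) H ∧ |τ + ‖ξ‖ - ‖ξ + p‖| ≤ m ∧
      y - ξ ∈ cyl ξ (a * N₂) (a * ρ)} ≤
      ENNReal.ofReal (8 * A ^ 3 / a * (2 ^ d * ((1 + A) * a) * (3 * a) ^ (d - 1)) *
        (N₂ * ρ ^ (d - 1) * min 1 (N₁ * m / N₂ / H))) := by
  set S := {ξ : EuclideanSpace ℝ (Fin d) | SimBy A ‖ξ‖ N₁ ∧ SimBy A ‖ξ + p‖ N₃ ∧
      SimBy A (‖ξ‖ + ‖p‖ - ‖ξ + p‖) H ∧ |τ + ‖ξ‖ - ‖ξ + p‖| ≤ m ∧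
      y - ξ ∈ cyl ξ (a * N₂) (a * ρ)} with hS
  have hA0 : 0 < A := by linarith
  have hSm : MeasurableSet S := by
    rw [hS]
    simp only [cyl, perp, Set.mem_ofPred_eq]
    refine measurableSet_and ?_ (measurableSet_and ?_ (measurableSet_and ?_
      (measurableSet_and ?_ (measurableSet_and ?_ ?_))))
    · exact measurableSet_simBy (by fun_prop) _ _
    · exact measurableSet_simBy (by fun_prop) _ _
    · exact measurableSet_simBy (by fun_prop) _ _
    · apply measurableSet_le <;> fun_prop
    · apply measurableSet_le <;> fun_prop
    · apply measurableSet_le <;> fun_prop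
  have ha0 : 0 < a := by rw [ha]; positivity
  have ha9 : a * A ^ 9 = 1 / 128 := by rw [ha]; field_simp
  have hApow : ∀ k ≤ 9, a * A ^ k ≤ 1 / 128 := by
    intro k hk
    rw [← ha9]
    gcongr
  have ha1 : a ≤ 1 / 128 := by simpa using hApow 0 (by norm_num)
  have hρN : ρ ≤ A * N₂ := by
    refine (sq_le_sq₀ hρ.le (by positivity)).1 ?_
    rw [hρ2]
    nlinarith [mul_pos hN₂ hN₂, mul_le_mul_of_nonneg_left hH2 hN₂.le]
  -- size of the frequencies and distance of their directions from those of `y` and `y + p`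
  have hfar : ∀ ξ ∈ S, 0 < ‖ξ‖ ∧ 0 < ‖ξ + p‖ ∧ 0 < ‖y‖ ∧
      ‖dir ξ - dir y‖ * N₁ ≤ 4 * A * (a * ρ) ∧
      ‖dir (ξ + p) - dir (y + p)‖ * N₁ ≤ 12 * A ^ 6 * (a * ρ) := by
    rintro ξ ⟨h1, h2, h3, h4, h5, h6⟩
    have hNξ : N₁ ≤ A * ‖ξ‖ := h1.2
    have hNη : N₁ ≤ A ^ 2 * ‖ξ + p‖ := by
      calc N₁ ≤ A * (A * ‖ξ + p‖) := h13.trans (by gcongr; exact h2.2)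
        _ = _ := by ring
    have hξ0 : 0 < ‖ξ‖ := pos_of_mul_pos_right (hN₁.trans_le hNξ) (by positivity)
    have hη0 : 0 < ‖ξ + p‖ := pos_of_mul_pos_right (hN₁.trans_le hNη) (by positivity)
    have hr1 : ‖y - ξ‖ ≤ ‖ξ‖ / 2 := by
      calc ‖y - ξ‖ ≤ a * N₂ := h5
        _ ≤ a * (A * (A * ‖ξ‖)) := by gcongr; exact h21.trans (by gcongr)
        _ = (a * A ^ 2) * ‖ξ‖ := by ring
        _ ≤ 1 / 128 * ‖ξ‖ := by gcongr; exact hApow 2 (by norm_num)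
        _ ≤ ‖ξ‖ / 2 := by linarith
    have hr2 : ‖y - ξ‖ ≤ ‖ξ + p‖ / 2 := by
      calc ‖y - ξ‖ ≤ a * N₂ := h5
        _ ≤ a * (A * (A ^ 2 * ‖ξ + p‖)) := by gcongr; exact h21.trans (by gcongr)
        _ = (a * A ^ 3) * ‖ξ + p‖ := by ring
        _ ≤ 1 / 128 * ‖ξ + p‖ := by gcongr; exact hApow 3 (by norm_num)
        _ ≤ ‖ξ + p‖ / 2 := by linarith
    obtain ⟨hy0, hy1⟩ := norm_dir_sub_dir_mul_norm_le hξ0 hr1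
    have ey : y + p - (ξ + p) = y - ξ := by abel
    obtain ⟨hq0, hq1⟩ := norm_dir_sub_dir_mul_norm_le (y := y + p) hη0 (by rwa [ey])
    rw [ey] at hq1
    refine ⟨hξ0, hη0, hy0, ?_, ?_⟩
    · calc ‖dir ξ - dir y‖ * N₁ ≤ ‖dir ξ - dir y‖ * (A * ‖ξ‖) := by gcongr
        _ = A * (‖dir ξ - dir y‖ * ‖ξ‖) := by ring
        _ ≤ A * (4 * (a * ρ)) := mul_le_mul_of_nonneg_left
          (hy1.trans (mul_le_mul_of_nonneg_left h6 (by norm_num))) hA0.le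
        _ = _ := by ring
    · have hch := norm_perp_change ξ (ξ + p) (y - ξ)
      have hup := norm_dir_sub_dir_add_le hA hN₁ hN₂ hH hρ hρ2 h13 hp h1 h2 h3
      have hb : ‖perp (ξ + p) (y - ξ)‖ ≤ 3 * A ^ 4 * (a * ρ) := by
        have h7 : ‖y - ξ‖ * ‖dir ξ - dir (ξ + p)‖ ≤ 2 * A ^ 4 * (a * ρ) := by
          calc ‖y - ξ‖ * ‖dir ξ - dir (ξ + p)‖
              ≤ (a * (A * N₁)) * ‖dir ξ - dir (ξ + p)‖ := by
                gcongr
                exact h5.trans (by gcongr)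
            _ = a * A * (‖dir ξ - dir (ξ + p)‖ * N₁) := by ring
            _ ≤ a * A * (2 * A ^ 3 * ρ) := by gcongr
            _ = _ := by ring
        have h8 : a * ρ ≤ A ^ 4 * (a * ρ) :=
          le_mul_of_one_le_left (by positivity) (one_le_pow₀ hA)
        linarith [h6]
      calc ‖dir (ξ + p) - dir (y + p)‖ * N₁
          ≤ ‖dir (ξ + p) - dir (y + p)‖ * (A ^ 2 * ‖ξ + p‖) := by gcongr
        _ = A ^ 2 * (‖dir (ξ + p) - dir (y + p)‖ * ‖ξ + p‖) := by ring
        _ ≤ A ^ 2 * (4 * (3 * A ^ 4 * (a * ρ))) := mul_le_mul_of_nonneg_left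
          (hq1.trans (mul_le_mul_of_nonneg_left hb (by norm_num))) (by positivity)
        _ = _ := by ring
  rcases S.eq_empty_or_nonempty with hSe | ⟨ξ₀, hξ₀⟩
  · rw [hSe, measure_empty]; exact zero_le
  have hy0 : 0 < ‖y‖ := (hfar ξ₀ hξ₀).2.2.1
  have hperp : ∀ ξ ∈ S, ‖perp y (ξ - y)‖ ≤ 2 * (a * ρ) := by
    intro ξ hξ
    obtain ⟨-, -, -, hd, -⟩ := hfar ξ hξ
    obtain ⟨h1, h2, h3, h4, h5, h6⟩ := hξ
    rw [← neg_sub, perp_neg, norm_neg]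
    refine (norm_perp_change ξ y (y - ξ)).trans ?_
    have h7 : ‖y - ξ‖ * ‖dir ξ - dir y‖ ≤ a * ρ := by
      calc ‖y - ξ‖ * ‖dir ξ - dir y‖ ≤ (a * (A * N₁)) * ‖dir ξ - dir y‖ := by
            gcongr
            exact h5.trans (by gcongr)
        _ = a * A * (‖dir ξ - dir y‖ * N₁) := by ring
        _ ≤ a * A * (4 * A * (a * ρ)) := by gcongr
        _ = 4 * (a * A ^ 2) * (a * ρ) := by ring
        _ ≤ 4 * (1 / 128) * (a * ρ) := by gcongr; exact hApow 2 (by norm_num)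
        _ ≤ a * ρ := by nlinarith [mul_pos ha0 hρ]
    linarith [h6]
  set D : Set (EuclideanSpace ℝ (Fin d)) :=
    {x | x - y ∈ cyl y ((1 + A) * a * N₂) (3 * a * ρ)} with hDdef
  have hDvol : volume D ≤ ENNReal.ofReal ((2 ^ d * ((1 + A) * a) * (3 * a) ^ (d - 1)) *
      (N₂ * ρ ^ (d - 1))) := by
    refine (volume_preimage_cyl_le (norm_pos_iff.1 hy0) y (by positivity) (by positivity)).trans
      (le_of_eq ?_)
    rw [mul_pow _ ρ]
    congr 1; ring
  have haρ : a * ρ ≤ A * (a * N₂) := by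
    calc a * ρ ≤ a * (A * N₂) := by gcongr
      _ = _ := by ring
  have hSD : S ⊆ D := by
    intro ξ hξ
    refine ⟨?_, (hperp ξ hξ).trans (by linarith [mul_pos ha0 hρ])⟩
    rw [norm_sub_rev]
    refine hξ.2.2.2.2.1.trans ?_
    nlinarith [mul_pos (mul_pos hA0 ha0) hN₂]
  have hκ : 1 ≤ 8 * A ^ 3 / a := by
    rw [one_le_div ha0]
    have : 1 ≤ A ^ 3 := one_le_pow₀ hA
    linarith
  refine le_ofReal_mul_min (((measure_mono hSD).trans hDvol).trans
    (ENNReal.ofReal_le_ofReal ?_)) ?_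
  · rw [mul_assoc (8 * A ^ 3 / a)]
    exact le_mul_of_one_le_left (by positivity) hκ
  rcases le_total (‖p‖ / 4) m with hmp | hmp
  · refine ((measure_mono hSD).trans hDvol).trans (ENNReal.ofReal_le_ofReal ?_)
    have : 1 ≤ 8 * A ^ 3 / a * (N₁ * m / N₂ / H) := by
      rw [div_div, div_mul_div_comm, one_le_div (by positivity)]
      have hpN : N₂ ≤ A * ‖p‖ := hp.2
      calc a * (N₂ * H) ≤ 1 * (A * ‖p‖ * (A * (A * N₁))) := by
            gcongr
            · linarith
            · exact hH2.trans (by gcongr)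
        _ ≤ 1 * (A * (4 * m) * (A * (A * N₁))) := by gcongr; linarith
        _ = 4 * (A ^ 3 * (N₁ * m)) := by ring
        _ ≤ 8 * (A ^ 3 * (N₁ * m)) := by gcongr; norm_num
        _ = _ := by ring
    calc _ ≤ (8 * A ^ 3 / a * (N₁ * m / N₂ / H)) *
        ((2 ^ d * ((1 + A) * a) * (3 * a) ^ (d - 1)) * (N₂ * ρ ^ (d - 1))) :=
          le_mul_of_one_le_left (by positivity) this
      _ = _ := by ring
  · set v := dir (dir (y + p) - dir y) with hv
    refine (volume_le_of_translate hSm v (l := 8 * A ^ 3 * (m * N₁) / ρ) (T := a * ρ)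
      (by positivity) (D := D) ?_ ?_).trans ?_
    · intro ξ hξ t ht hξ'
      obtain ⟨hξ0, hη0, -, hd1, hd2⟩ := hfar ξ hξ
      obtain ⟨-, -, -, hd3, -⟩ := hfar _ hξ'
      have k4 := abs_le.1 hξ'.2.2.2.1
      obtain ⟨h1, h2, h3, h4, h5, h6⟩ := hξ
      have h4' := abs_le.1 h4
      set ξ' := ξ + t • v with hξ'def
      have hlow := le_norm_dir_sub_dir_add hA hN₁ hH hρ hρ2 h31 hp h1 h2 h3 hξ0 hη0
        (by linarith)
      -- the gradient of `|ξ + p| - |ξ|` varies by less than a quarter of its size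
      have hgrad : ρ ≤ 4 * A ^ 3 * (⟪v, dir (ξ + p) - dir ξ'⟫ * N₁) := by
        have e : ⟪v, dir (ξ + p) - dir ξ'⟫ = ‖dir (y + p) - dir y‖ +
            ⟪v, dir (ξ + p) - dir (y + p)⟫ - ⟪v, dir ξ' - dir y⟫ := by
          have h0 := inner_dir_self (dir (y + p) - dir y)
          rw [← h0, ← hv, ← inner_add_right, ← inner_sub_right]
          congr 1; abel
        have b1 : -‖dir (ξ + p) - dir (y + p)‖ ≤ ⟪v, dir (ξ + p) - dir (y + p)⟫ := by
          have := neg_le_of_abs_le (abs_real_inner_le_norm v (dir (ξ + p) - dir (y + p)))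
          have := mul_le_of_le_one_left (norm_nonneg (dir (ξ + p) - dir (y + p)))
            (norm_dir_le (dir (y + p) - dir y))
          linarith
        have b2 : ⟪v, dir ξ' - dir y⟫ ≤ ‖dir ξ' - dir y‖ :=
          (real_inner_le_norm _ _).trans (mul_le_of_le_one_left (norm_nonneg _)
            (norm_dir_le (dir (y + p) - dir y)))
        have b3 : ‖dir ξ - dir (ξ + p)‖ ≤ ‖dir ξ - dir y‖ + ‖dir (y + p) - dir y‖ +
            ‖dir (ξ + p) - dir (y + p)‖ := by
          have e3 : dir ξ - dir (ξ + p) = (dir ξ - dir y) - (dir (y + p) - dir y) -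
            (dir (ξ + p) - dir (y + p)) := by abel
          rw [e3]
          exact (norm_sub_le _ _).trans (add_le_add_left (norm_sub_le _ _) _)
        have b4 : (‖dir ξ - dir (ξ + p)‖ - ‖dir ξ - dir y‖ - ‖dir ξ' - dir y‖ -
            2 * ‖dir (ξ + p) - dir (y + p)‖) * N₁ ≤ ⟪v, dir (ξ + p) - dir ξ'⟫ * N₁ := by
          gcongr
          linarith
        have hA6 : A ≤ A ^ 6 := le_self_pow₀ hA (by norm_num)
        have b5 : ‖dir ξ - dir (ξ + p)‖ * N₁ - 32 * A ^ 6 * (a * ρ) ≤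
            ⟪v, dir (ξ + p) - dir ξ'⟫ * N₁ := by
          have : A * (a * ρ) ≤ A ^ 6 * (a * ρ) := by gcongr
          linarith
        have b6 : A ^ 3 * (32 * A ^ 6 * (a * ρ)) = ρ / 4 := by
          calc A ^ 3 * (32 * A ^ 6 * (a * ρ)) = 32 * (a * A ^ 9) * ρ := by ring
            _ = ρ / 4 := by rw [ha9]; ring
        have b7 := mul_le_mul_of_nonneg_left b5 (show 0 ≤ A ^ 3 by positivity)
        rw [mul_sub, b6] at b7
        linarith
      have c1 := norm_add_ge (ξ + p) (t • v)
      have c2 := norm_add_ge ξ' (-(t • v))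
      rw [inner_smul_right, show ξ + p + t • v = ξ' + p by rw [hξ'def]; abel] at c1
      rw [inner_neg_right, inner_smul_right,
        show ξ' + -(t • v) = ξ by rw [hξ'def]; abel] at c2
      have c3 : t * ⟪v, dir (ξ + p) - dir ξ'⟫ ≤ 2 * m := by
        rw [inner_sub_right, real_inner_comm _ v, real_inner_comm _ v]
        linarith
      rw [le_div_iff₀ hρ]
      calc t * ρ ≤ t * (4 * A ^ 3 * (⟪v, dir (ξ + p) - dir ξ'⟫ * N₁)) := by gcongr
        _ = 4 * A ^ 3 * ((t * ⟪v, dir (ξ + p) - dir ξ'⟫) * N₁) := by ring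
        _ ≤ 4 * A ^ 3 * ((2 * m) * N₁) := by gcongr
        _ = _ := by ring
    · intro x s hs hx
      have hsv : ‖s • v‖ ≤ a * ρ := by
        rw [norm_smul, Real.norm_eq_abs, abs_of_nonneg hs.1]
        exact (mul_le_of_le_one_right hs.1 (norm_dir_le _)).trans hs.2
      have e : x - y = (x + s • v - y) - s • v := by abel
      refine ⟨?_, ?_⟩
      · rw [e]
        refine (norm_sub_le _ _).trans ?_
        have := hx.2.2.2.2.1
        rw [norm_sub_rev] at this
        calc _ ≤ a * N₂ + A * (a * N₂) := add_le_add this (hsv.trans haρ)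
          _ = _ := by ring
      · rw [e, perp_sub]
        refine (norm_sub_le _ _).trans ?_
        calc _ ≤ 2 * (a * ρ) + a * ρ :=
              add_le_add (hperp _ hx) ((norm_perp_le _ _).trans hsv)
          _ = _ := by ring
    · refine (mul_le_mul_right hDvol _).trans ?_
      rw [← ENNReal.ofReal_mul (by positivity)]
      apply ENNReal.ofReal_le_ofReal
      apply le_of_eq
      have : 8 * A ^ 3 * (m * N₁) / ρ / (a * ρ) = 8 * A ^ 3 / a * (N₁ * m / N₂ / H) := by
        rw [div_div, div_div, div_mul_div_comm, ← hρ2]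
        congr 1 <;> ring
      rw [this]
      ring

end LocalizedSpatialSet

/-! ### Fibres in space-time -/

section Fibers
variable {d : ℕ}

theorem TriBound.swap₁₃ {Z : Type*} [AddCommGroup Z] [MeasureSpace Z] [MeasurableAdd₂ Z]
    [MeasurableNeg Z] [SFinite (volume : Measure Z)] [(volume : Measure Z).IsAddLeftInvariant]
    [(volume : Measure Z).IsNegInvariant] {E : Set (Z × Z × Z)} {c : ℝ≥0∞}
    (hE : MeasurableSet E) (h : TriBound {q | (q.2.2, q.2.1, q.1) ∈ E} c) : TriBound E c := by
  refine TriBound.swap₁₂ hE (TriBound.swap₂₃ (TriBound.swap₁₂ ?_ h))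
  exact (show Measurable fun q : Z × Z × Z => (q.2.2, q.1, q.2.1) by fun_prop) hE

instance : (volume : Measure (FreqSpace d)).IsAddHaarMeasure :=
  Measure.prod.instIsAddHaarMeasure _ _

/-- A set of points `(ξ, τ)` with `ξ ∈ S` and `τ` in two intervals depending on `ξ`. -/
theorem volume_le_of_mem_slab {F : Set (FreqSpace d)} (hF : MeasurableSet F)
    (S : Set (EuclideanSpace ℝ (Fin d))) {c₁ c₂ : EuclideanSpace ℝ (Fin d) → ℝ} {m₁ m₂ : ℝ}
    (h : ∀ z ∈ F, z.1 ∈ S ∧ |z.2 - c₁ z.1| ≤ m₁ ∧ |z.2 - c₂ z.1| ≤ m₂) :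
    volume F ≤ ENNReal.ofReal (2 * min m₁ m₂) * volume S := by
  have e := Measure.prod_apply (μ := (volume : Measure (EuclideanSpace ℝ (Fin d))))
    (ν := (volume : Measure ℝ)) hF
  refine e.le.trans ((lintegral_mono fun ξ => ?_).trans (lintegral_indicator_const_le S _))
  by_cases hξ : ξ ∈ S
  · rw [Set.indicator_of_mem hξ]
    have hsub : ∀ (c m : ℝ), (∀ t, (ξ, t) ∈ F → |t - c| ≤ m) →
        volume (Prod.mk ξ ⁻¹' F) ≤ ENNReal.ofReal (2 * m) := by
      intro c m hc
      refine (measure_mono (t := Set.Icc (c - m) (c + m)) fun t ht => ?_).trans (le_of_eq ?_)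
      · have := abs_le.1 (hc t ht)
        exact ⟨by linarith, by linarith⟩
      · rw [Real.volume_Icc]; congr 1; ring
    rcases min_choice m₁ m₂ with hm | hm <;> rw [hm]
    · exact hsub (c₁ ξ) _ fun t ht => (h (ξ, t) ht).2.1
    · exact hsub (c₂ ξ) _ fun t ht => (h (ξ, t) ht).2.2
  · rw [Set.indicator_of_notMem hξ]
    refine le_of_eq ?_
    convert measure_empty (μ := (volume : Measure ℝ))
    ext t
    simp only [Set.mem_preimage, Set.mem_empty_iff_false, iff_false]
    exact fun ht => hξ (h _ ht).1

/-- Localised Cauchy-Schwarz with the spatial part of the second frequency, and of minus the third,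
localised to cylinders with axis along this frequency. -/
theorem triBound_of_cyl_localized_fiber [NeZero d]
    {E : Set (FreqSpace d × FreqSpace d × FreqSpace d)}
    (hE : MeasurableSet E) {r s k : ℝ} (hr : 0 < r) (hs : 0 < s) (hk : 0 < k) {M : ℝ≥0∞}
    (hne : ∀ q ∈ E, q.2.1.1 ≠ 0 ∧ q.2.2.1 ≠ 0)
    (hloc : ∀ q ∈ E, ∀ y, y - q.2.1.1 ∈ cyl q.2.1.1 r s →
      y + q.2.2.1 ∈ cyl (-q.2.2.1) (k * r) (k * s))
    (hM : ∀ x y, volume {w : FreqSpace d | (x, w, -x - w) ∈ E ∧ y - w.1 ∈ cyl w.1 r s} ≤ M) :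
    TriBound E ((ENNReal.ofReal (k ^ d) * M) ^ (1 / 2 : ℝ)) := by
  set e₀ : EuclideanSpace ℝ (Fin d) := EuclideanSpace.single 0 1
  set v := volume (cyl e₀ r s) with hv
  have hv0 : v ≠ 0 := volume_cyl_ne_zero _ hr hs
  have hv1 : v ≠ ∞ := volume_cyl_ne_top _ _ _
  have hfib : ∀ (u y₀ : EuclideanSpace ℝ (Fin d)) (r s : ℝ), u ≠ 0 →
      volume {y | y - y₀ ∈ cyl u r s} = volume (cyl e₀ r s) := by
    intro u y₀ r s hu
    rw [← volume_cyl_eq hu]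
    simp only [sub_eq_add_neg]
    exact measure_preimage_add_right volume (-y₀) (cyl u r s)
  have key := triBound_of_localized_fiber (volume : Measure (EuclideanSpace ℝ (Fin d))) hE
    (W₁ := {p | p.1.1 ≠ 0 ∧ p.2 - p.1.1 ∈ cyl p.1.1 r s})
    (W₂ := {p | p.1.1 ≠ 0 ∧ p.2 - -p.1.1 ∈ cyl (-p.1.1) (k * r) (k * s)})
    (a := v) (b₁ := v) (b₂ := ENNReal.ofReal (k ^ d) * v) (M := M) ?_ ?_ ?_ ?_ ?_ ?_ ?_ hv0 hv1
  · convert key using 1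
    have e1 : M * v * (ENNReal.ofReal (k ^ d) * v) =
        (ENNReal.ofReal (k ^ d) * M) * v ^ (2 : ℝ) := by
      rw [ENNReal.rpow_two]; ring
    rw [e1, ENNReal.mul_rpow_of_nonneg (ENNReal.ofReal (k ^ d) * M) _ (by norm_num),
      ← ENNReal.rpow_mul,
      show (2 : ℝ) * (1 / 2) = 1 by norm_num, ENNReal.rpow_one]
    rw [ENNReal.mul_div_cancel_right hv0 hv1]
  · simp only [cyl, perp, Set.mem_ofPred_eq]
    refine measurableSet_and ?_ (measurableSet_and ?_ ?_)
    · exact (show Measurable fun p : FreqSpace d × EuclideanSpace ℝ (Fin d) => p.1.1 by fun_prop)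
        (measurableSet_singleton 0).compl
    · apply measurableSet_le <;> fun_prop
    · apply measurableSet_le <;> fun_prop
  · simp only [cyl, perp, Set.mem_ofPred_eq]
    refine measurableSet_and ?_ (measurableSet_and ?_ ?_)
    · exact (show Measurable fun p : FreqSpace d × EuclideanSpace ℝ (Fin d) => p.1.1 by fun_prop)
        (measurableSet_singleton 0).compl
    · apply measurableSet_le <;> fun_prop
    · apply measurableSet_le <;> fun_prop
  · rintro q hq y ⟨-, hy⟩
    refine ⟨(hne q hq).2, ?_⟩
    rw [sub_neg_eq_add]
    exact hloc q hq y hy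
  · intro q hq
    rw [hv, ← hfib q.2.1.1 q.2.1.1 r s (hne q hq).1]
    exact measure_mono fun y hy => ⟨(hne q hq).1, hy⟩
  · intro z
    by_cases hz : z.1 = 0
    · simp [hz]
    · rw [hv, ← hfib z.1 z.1 r s hz]
      exact measure_mono fun y hy => hy.2
  · intro z
    by_cases hz : z.1 = 0
    · simp [hz]
    · rw [hv, ← volume_cyl_smul _ _ _ hk, ← hfib (-z.1) (-z.1) _ _ (neg_ne_zero.2 hz)]
      exact measure_mono fun y hy => hy.2
  · intro x y
    refine (measure_mono ?_).trans (hM x y)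
    exact fun w hw => ⟨hw.1, hw.2.2⟩

end Fibers

/-! ### Dyadic blocks -/

section Block

/-- The support of the dyadic block in the `(++-)` case, as a set of triples of sum zero. -/
def blockSet (d : ℕ) (A N₁ N₂ N₃ L₁ L₂ L₃ H : ℝ) :
    Set (FreqSpace d × FreqSpace d × FreqSpace d) :=
  {q | q.1 + q.2.1 + q.2.2 = 0 ∧ SimBy A (|‖q.1.1‖ + ‖q.2.1.1‖ - ‖q.2.2.1‖|) H ∧
    (SimBy A ‖q.1.1‖ N₁ ∧ 0 ≤ q.1.2 ∧ SimBy A (|q.1.2 - ‖q.1.1‖|) L₁) ∧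
    (SimBy A ‖q.2.1.1‖ N₂ ∧ 0 ≤ q.2.1.2 ∧ SimBy A (|q.2.1.2 - ‖q.2.1.1‖|) L₂) ∧
    (SimBy A ‖q.2.2.1‖ N₃ ∧ q.2.2.2 ≤ 0 ∧ SimBy A (|q.2.2.2 + ‖q.2.2.1‖|) L₃)}

variable {d : ℕ} {A N₁ N₂ N₃ L₁ L₂ L₃ H : ℝ}

theorem measurableSet_blockSet : MeasurableSet (blockSet d A N₁ N₂ N₃ L₁ L₂ L₃ H) := by
  unfold blockSet
  refine measurableSet_and ?_ (measurableSet_and ?_ (measurableSet_and ?_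
    (measurableSet_and ?_ ?_)))
  · exact (show Measurable fun q : FreqSpace d × FreqSpace d × FreqSpace d =>
      q.1 + q.2.1 + q.2.2 by fun_prop) (measurableSet_singleton 0)
  · exact measurableSet_simBy (by fun_prop) _ _
  · refine measurableSet_and ?_ (measurableSet_and ?_ ?_)
    · exact measurableSet_simBy (by fun_prop) _ _
    · apply measurableSet_le <;> fun_prop
    · exact measurableSet_simBy (by fun_prop) _ _
  · refine measurableSet_and ?_ (measurableSet_and ?_ ?_)
    · exact measurableSet_simBy (by fun_prop) _ _
    · apply measurableSet_le <;> fun_prop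
    · exact measurableSet_simBy (by fun_prop) _ _
  · refine measurableSet_and ?_ (measurableSet_and ?_ ?_)
    · exact measurableSet_simBy (by fun_prop) _ _
    · apply measurableSet_le <;> fun_prop
    · exact measurableSet_simBy (by fun_prop) _ _

theorem mem_blockSet_swap {z₁ z₂ z₃ : FreqSpace d}
    (h : (z₁, z₂, z₃) ∈ blockSet d A N₁ N₂ N₃ L₁ L₂ L₃ H) :
    (z₂, z₁, z₃) ∈ blockSet d A N₂ N₁ N₃ L₂ L₁ L₃ H := by
  obtain ⟨h0, h1, h2, h3, h4⟩ := h
  refine ⟨?_, ?_, h3, h2, h4⟩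
  · simp only at h0 ⊢; rw [← h0]; abel
  · simp only at h1 ⊢; rwa [add_comm ‖z₂.1‖]

theorem SimBy.mono {A B x y : ℝ} (h : SimBy A x y) (hAB : A ≤ B) (hx : 0 ≤ x) (hy : 0 ≤ y) :
    SimBy B x y :=
  ⟨h.1.trans (by gcongr), h.2.trans (by gcongr)⟩

theorem mem_blockSet_mono {B : ℝ} (hAB : A ≤ B) (hN₁ : 0 ≤ N₁) (hN₂ : 0 ≤ N₂) (hN₃ : 0 ≤ N₃)
    (hL₁ : 0 ≤ L₁) (hL₂ : 0 ≤ L₂) (hL₃ : 0 ≤ L₃) (hH : 0 ≤ H)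
    {q : FreqSpace d × FreqSpace d × FreqSpace d}
    (h : q ∈ blockSet d A N₁ N₂ N₃ L₁ L₂ L₃ H) : q ∈ blockSet d B N₁ N₂ N₃ L₁ L₂ L₃ H := by
  obtain ⟨h0, h1, ⟨h2, h3, h4⟩, ⟨h5, h6, h7⟩, ⟨h8, h9, h10⟩⟩ := h
  exact ⟨h0, h1.mono hAB (abs_nonneg _) hH,
    ⟨h2.mono hAB (norm_nonneg _) hN₁, h3, h4.mono hAB (abs_nonneg _) hL₁⟩,
    ⟨h5.mono hAB (norm_nonneg _) hN₂, h6, h7.mono hAB (abs_nonneg _) hL₂⟩,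
    ⟨h8.mono hAB (norm_nonneg _) hN₃, h9, h10.mono hAB (abs_nonneg _) hL₃⟩⟩

theorem resonance_nonneg {z₁ z₂ z₃ : FreqSpace d} (h : z₁ + z₂ + z₃ = 0) :
    0 ≤ ‖z₁.1‖ + ‖z₂.1‖ - ‖z₃.1‖ := by
  have : z₃.1 = -(z₁.1 + z₂.1) := by
    have := congrArg Prod.fst h
    exact eq_neg_of_add_eq_zero_right this
  rw [this, norm_neg]
  linarith [norm_add_le z₁.1 z₂.1]

/-- In a high-high `(++)` interaction the resonance function is comparable to the high frequency,
and a small third modulation forces the other two to be comparable to it as well. -/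
theorem blockSet_high_high (hA : 1 ≤ A) (hK : 8 * A ^ 2 * N₃ ≤ N₂)
    {q : FreqSpace d × FreqSpace d × FreqSpace d}
    (h : q ∈ blockSet d A N₁ N₂ N₃ L₁ L₂ L₃ H) :
    SimBy (8 * A ^ 2) H N₂ ∧
      (8 * A ^ 2 * L₃ ≤ N₂ → SimBy (8 * A ^ 2) L₁ N₂ ∧ SimBy (8 * A ^ 2) L₂ N₂) := by
  obtain ⟨z₁, z₂, z₃⟩ := q
  obtain ⟨h0, h1, ⟨h2, h3, h4⟩, ⟨h5, h6, h7⟩, ⟨h8, h9, h10⟩⟩ := h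
  simp only at h0 h1 h2 h3 h4 h5 h6 h7 h8 h9 h10
  have hA0 : 0 < A := by linarith
  rw [abs_of_nonneg (resonance_nonneg h0)] at h1
  have hsp : z₁.1 + z₂.1 + z₃.1 = 0 := congrArg Prod.fst h0
  have htm : z₁.2 + z₂.2 + z₃.2 = 0 := congrArg Prod.snd h0
  have t1 : ‖z₁.1‖ ≤ ‖z₂.1‖ + ‖z₃.1‖ := by
    have e : z₁.1 = -(z₂.1 + z₃.1) := eq_neg_of_add_eq_zero_left (by rw [← hsp]; abel)
    rw [e, norm_neg]; exact norm_add_le _ _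
  have t2 : ‖z₂.1‖ ≤ ‖z₁.1‖ + ‖z₃.1‖ := by
    have e : z₂.1 = -(z₁.1 + z₃.1) := eq_neg_of_add_eq_zero_left (by rw [← hsp]; abel)
    rw [e, norm_neg]; exact norm_add_le _ _
  have small : ∀ x y : ℝ, x ≤ A * y → 8 * A ^ 2 * y ≤ N₂ → 8 * x ≤ ‖z₂.1‖ := by
    intro x y hxy hy
    have : A * (8 * x) ≤ A * ‖z₂.1‖ := by
      calc A * (8 * x) ≤ A * (8 * (A * y)) := by gcongr
        _ = 8 * A ^ 2 * y := by ring
        _ ≤ A * ‖z₂.1‖ := hy.trans h5.2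
    exact le_of_mul_le_mul_left this hA0
  have s3 : 8 * ‖z₃.1‖ ≤ ‖z₂.1‖ := small _ _ h8.1 hK
  have n3 := norm_nonneg z₃.1
  have comp : ∀ x y : ℝ, SimBy A x y → ‖z₂.1‖ ≤ 8 * x → x ≤ 8 * ‖z₂.1‖ →
      SimBy (8 * A ^ 2) y N₂ := by
    intro x y hxy hl hu
    constructor
    · calc y ≤ A * x := hxy.2
        _ ≤ A * (8 * (A * N₂)) := by gcongr; exact hu.trans (by gcongr; exact h5.1)
        _ = _ := by ring
    · calc N₂ ≤ A * ‖z₂.1‖ := h5.2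
        _ ≤ A * (8 * (A * y)) := by gcongr; exact hl.trans (by gcongr; exact hxy.1)
        _ = _ := by ring
  refine ⟨comp _ _ h1 (by linarith) (by linarith), fun hL => ?_⟩
  have s4 := small _ _ h10.1 hL
  have s5 := abs_le.1 (show |z₃.2 + ‖z₃.1‖| ≤ ‖z₂.1‖ / 8 by linarith)
  constructor
  · refine comp _ _ h4 ?_ ?_
    · rw [abs_sub_comm, abs_of_nonneg (by linarith)]; linarith
    · rw [abs_sub_comm, abs_of_nonneg (by linarith)]; linarith
  · refine comp _ _ h7 ?_ ?_
    · rw [abs_sub_comm, abs_of_nonneg (by linarith)]; linarith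
    · rw [abs_sub_comm, abs_of_nonneg (by linarith)]; linarith

theorem triBound_of_forall_notMem {Z : Type*} [AddCommGroup Z] [MeasureSpace Z]
    {E : Set (Z × Z × Z)} (h : ∀ q, q ∉ E) (c : ℝ≥0∞) : TriBound E c := by
  intro g₁ g₂ g₃ _ _ _
  simp [h]

end Block

/-! ### Inequalities between real numbers -/

section Numbers

theorem ofReal_rpow_half_le {c l m X Y : ℝ} (hc : 0 ≤ c) (hl : 0 ≤ l) (hm : 0 ≤ m) (hX : 0 ≤ X)
    (hY : 0 ≤ Y) :
    ENNReal.ofReal (c * (l * m * (X * Y) ^ 2)) ^ (1 / 2 : ℝ) ≤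
      ENNReal.ofReal ((1 + c) * X * l ^ (1 / 2 : ℝ) * m ^ (1 / 2 : ℝ) * Y) := by
  rw [ENNReal.ofReal_rpow_of_nonneg (by positivity) (by norm_num), ← Real.sqrt_eq_rpow,
    ← Real.sqrt_eq_rpow, ← Real.sqrt_eq_rpow]
  apply ENNReal.ofReal_le_ofReal
  rw [Real.sqrt_le_left (by positivity)]
  calc c * (l * m * (X * Y) ^ 2) ≤ (1 + c) ^ 2 * (l * m * (X * Y) ^ 2) := by
        gcongr
        nlinarith
    _ = _ := by
        simp only [mul_pow, Real.sq_sqrt hl, Real.sq_sqrt hm]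
        ring

theorem mul_sqrt_pow_div_eq {d : ℕ} (hd : 1 ≤ d) {n H : ℝ} (hn : 0 < n) (hH : 0 < H) :
    n * √(n * H) ^ (d - 1) / H =
      ((H / n) ^ (((d : ℝ) - 3) / 4) * n ^ (((d : ℝ) - 1) / 2)) ^ 2 := by
  obtain ⟨a, rfl⟩ : ∃ a, n = Real.exp a := ⟨_, (Real.exp_log hn).symm⟩
  obtain ⟨b, rfl⟩ : ∃ b, H = Real.exp b := ⟨_, (Real.exp_log hH).symm⟩
  rw [Real.sqrt_eq_rpow, ← Real.exp_add, ← Real.exp_mul, ← Real.exp_nat_mul, ← Real.exp_add,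
    ← Real.exp_sub, ← Real.exp_sub, ← Real.exp_mul, ← Real.exp_mul, ← Real.exp_add,
    ← Real.exp_nat_mul, Nat.cast_sub hd]
  congr 1
  push_cast
  ring

theorem min_one_mul_div_le {k t H : ℝ} (hk : 1 ≤ k) (hH : 0 < H) :
    min 1 (k * t / H) ≤ k * (min H t / H) := by
  rw [← min_div_div_right hH.le, div_self hH.ne', mul_min_of_nonneg _ _ (by linarith),
    mul_one, mul_div_assoc]
  exact min_le_min_right _ hk

end Numbers

/-! ### Estimates with one frequency fixed -/

section Cases
variable {d : ℕ} {A N₁ N₂ N₃ L₁ L₂ L₃ H : ℝ}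

theorem TriBound.mono {Z : Type*} [AddCommGroup Z] [MeasureSpace Z] {E : Set (Z × Z × Z)}
    {c c' : ℝ≥0∞} (h : TriBound E c) (hc : c ≤ c') : TriBound E c' := fun g₁ g₂ g₃ h₁ h₂ h₃ =>
  (h g₁ g₂ g₃ h₁ h₂ h₃).trans (mul_le_mul_left hc _)

/-- On triples of sum zero the absolute value of the resonance function may be dropped. -/
theorem resonance_mem {z₁ z₂ z₃ : FreqSpace d} (h : z₁ + z₂ + z₃ = 0)
    (h1 : SimBy A (|‖z₁.1‖ + ‖z₂.1‖ - ‖z₃.1‖|) H) :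
    SimBy A (‖z₁.1‖ + ‖z₂.1‖ - ‖z₃.1‖) H := by
  rwa [abs_of_nonneg (resonance_nonneg h)] at h1

theorem add_le_two_mul_max (hA : 0 ≤ A) (x y : ℝ) : A * x + A * y ≤ 2 * A * max x y := by
  have h1 : A * x ≤ A * max x y := by gcongr; exact le_max_left _ _
  have h2 : A * y ≤ A * max x y := by gcongr; exact le_max_right _ _
  linarith

theorem measurable_triple_left (x : FreqSpace d) :
    Measurable fun w : FreqSpace d => (x, w, -x - w) := by
  have : Measurable fun w : FreqSpace d => -x - w := by
    simp only [sub_eq_add_neg]; fun_prop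
  fun_prop

/-- Combines the bound for the spatial set with the bound `2 A min` for the temporal interval. -/
theorem fiber_bound {v₁ : ℝ≥0∞} {c x y R k t : ℝ} (hA : 1 ≤ A) (hc : 0 ≤ c) (hx : 0 ≤ x)
    (hy : 0 ≤ y) (hR : 0 ≤ R) (hk : 1 ≤ k) (hH : 0 < H)
    (h : v₁ ≤ ENNReal.ofReal (c * (R * min 1 (k * t / H)))) :
    ENNReal.ofReal (2 * min (A * x) (A * y)) * v₁ ≤
      ENNReal.ofReal (2 * A * c * k * (min x y * min H t * (R / H))) := by
  refine (mul_le_mul_right h _).trans ?_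
  rw [← ENNReal.ofReal_mul (by positivity)]
  apply ENNReal.ofReal_le_ofReal
  rw [← mul_min_of_nonneg _ _ (by linarith : 0 ≤ A)]
  calc 2 * (A * min x y) * (c * (R * min 1 (k * t / H)))
      ≤ 2 * (A * min x y) * (c * (R * (k * (min H t / H)))) := by
        gcongr
        exact min_one_mul_div_le hk hH
    _ = _ := by ring

theorem triBound_first_fixed [NeZero d] (hA : 1 ≤ A) (hN₁ : 0 < N₁)
    (hN₂ : 0 < N₂) (hL₂ : 0 < L₂) (hL₃ : 0 < L₃) (hH : 0 < H)
    (h31 : N₃ ≤ A * N₁) (h21 : N₂ ≤ A * N₁) (hH2 : H ≤ A * N₂) :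
    TriBound (blockSet d A N₁ N₂ N₃ L₁ L₂ L₃ H)
      (ENNReal.ofReal (2 * A * (2 ^ d * 16 * A ^ 6 * (2 ^ d * A * (2 * A ^ 3) ^ (d - 1))) *
        (2 * A) * (min L₂ L₃ * min H (max L₂ L₃) * (N₂ * √(N₂ * H) ^ (d - 1) / H))) ^
          (1 / 2 : ℝ)) := by
  have hA0 : 0 < A := by linarith
  refine triBound_of_fiber measurableSet_blockSet fun x => ?_
  rcases Set.eq_empty_or_nonempty {w : FreqSpace d |
    (x, w, -x - w) ∈ blockSet d A N₁ N₂ N₃ L₁ L₂ L₃ H} with he | ⟨w₀, hw₀⟩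
  · rw [he, measure_empty]; exact zero_le
  obtain ⟨-, -, ⟨hx1, hx2, -⟩, -, -⟩ := hw₀
  have hS := volume_first_fixed_le (τ := x.2) (m := 2 * A * max L₂ L₃) hA hN₁ hN₂ hH
    (Real.sqrt_pos.2 (mul_pos hN₂ hH)) (Real.sq_sqrt (by positivity)) (by positivity) hx2
    h31 h21 hH2 hx1
  refine le_trans (volume_le_of_mem_slab (measurable_triple_left x measurableSet_blockSet) _
    (c₁ := fun ξ => ‖ξ‖) (c₂ := fun ξ => ‖x.1 + ξ‖ - x.2) (m₁ := A * L₂) (m₂ := A * L₃) ?_)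
    (fiber_bound hA (by positivity) hL₂.le hL₃.le (by positivity) (by linarith) hH hS)
  rintro w ⟨h0, h1, -, ⟨h2, h3, h4⟩, ⟨h5, h6, h7⟩⟩
  have h1 := resonance_mem h0 h1
  have e1 : ‖(-x - w).1‖ = ‖x.1 + w.1‖ := by
    rw [show (-x - w).1 = -(x.1 + w.1) by simp [sub_eq_add_neg, add_comm], norm_neg]
  have e2 : (-x - w).2 = -x.2 - w.2 := by simp
  simp only [e1, e2] at h1 h2 h3 h4 h5 h6 h7
  have k1 := abs_le.1 h4.1
  have k2 := abs_le.1 h7.1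
  have k3 := add_le_two_mul_max hA0.le L₂ L₃
  exact ⟨⟨h2, h5, h1, abs_le.2 ⟨by linarith, by linarith⟩⟩, h4.1,
    abs_le.2 ⟨by linarith, by linarith⟩⟩

theorem triBound_third_fixed [NeZero d] (hA : 1 ≤ A) (hN₁ : 0 < N₁)
    (hN₂ : 0 < N₂) (hL₁ : 0 < L₁) (hL₂ : 0 < L₂) (hH : 0 < H) (h13 : N₁ ≤ A * N₃) :
    TriBound (blockSet d A N₁ N₂ N₃ L₁ L₂ L₃ H)
      (ENNReal.ofReal (2 * A * (2 ^ d * 16 * A ^ 6 * (2 ^ d * A * (2 * A ^ 3) ^ (d - 1))) *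
        (2 * A) * (min L₁ L₂ * min H (max L₁ L₂) * (N₂ * √(N₂ * H) ^ (d - 1) / H))) ^
          (1 / 2 : ℝ)) := by
  have hA0 : 0 < A := by linarith
  refine TriBound.swap₁₃ measurableSet_blockSet (triBound_of_fiber ?_ fun x => ?_)
  · exact (show Measurable fun q : FreqSpace d × FreqSpace d × FreqSpace d =>
      (q.2.2, q.2.1, q.1) by fun_prop) measurableSet_blockSet
  have hF : MeasurableSet {w : FreqSpace d |
      (x, w, -x - w) ∈ {q : FreqSpace d × FreqSpace d × FreqSpace d |
        (q.2.2, q.2.1, q.1) ∈ blockSet d A N₁ N₂ N₃ L₁ L₂ L₃ H}} :=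
    (show Measurable fun q : FreqSpace d × FreqSpace d × FreqSpace d =>
      (q.2.2, q.2.1, q.1) by fun_prop).comp (measurable_triple_left x) measurableSet_blockSet
  rcases Set.eq_empty_or_nonempty {w : FreqSpace d |
      (x, w, -x - w) ∈ {q : FreqSpace d × FreqSpace d × FreqSpace d |
        (q.2.2, q.2.1, q.1) ∈ blockSet d A N₁ N₂ N₃ L₁ L₂ L₃ H}} with he | ⟨w₀, hw₀⟩
  · rw [he, measure_empty]; exact zero_le
  obtain ⟨-, -, -, -, ⟨hx1, hx2, -⟩⟩ := hw₀
  have hx1 : SimBy A ‖-x.1‖ N₃ := by rw [norm_neg]; exact hx1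
  have hS := volume_third_fixed_le (τ := x.2) (m := 2 * A * max L₁ L₂) hA hN₁ hN₂ hH
    (Real.sqrt_pos.2 (mul_pos hN₂ hH)) (Real.sq_sqrt (by positivity)) (by positivity) h13 hx1
  rw [min_comm L₁ L₂]
  refine le_trans (volume_le_of_mem_slab hF _
    (c₁ := fun ξ => ‖ξ‖) (c₂ := fun ξ => -‖-x.1 - ξ‖ - x.2) (m₁ := A * L₂) (m₂ := A * L₁) ?_)
    (fiber_bound hA (by positivity) hL₂.le hL₁.le (by positivity) (by linarith) hH hS)
  rintro w ⟨h0, h1, ⟨h5, h6, h7⟩, ⟨h2, h3, h4⟩, -⟩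
  have h1 := resonance_mem h0 h1
  have e1 : (-x - w).1 = -x.1 - w.1 := by simp
  have e2 : (-x - w).2 = -x.2 - w.2 := by simp
  simp only [e1, e2] at h1 h2 h3 h4 h5 h6 h7
  have k1 := abs_le.1 h4.1
  have k2 := abs_le.1 h7.1
  have k3 := add_le_two_mul_max hA0.le L₁ L₂
  rw [← norm_neg x.1] at h1
  exact ⟨⟨h2, h5, h1, abs_le.2 ⟨by linarith, by linarith⟩⟩, h4.1,
    abs_le.2 ⟨by linarith, by linarith⟩⟩

theorem triBound_second_fixed [NeZero d] {a : ℝ} (hA : 1 ≤ A) (hN₁ : 0 < N₁)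
    (hN₂ : 0 < N₂) (hN₃ : 0 < N₃) (hL₁ : 0 < L₁) (hL₃ : 0 < L₃) (hH : 0 < H)
    (h13 : N₁ ≤ A * N₃) (h31 : N₃ ≤ A * N₁) (h21 : N₂ ≤ A * N₁) (hH2 : H ≤ A * N₂)
    (ha : a = 1 / (128 * A ^ 9)) :
    TriBound (blockSet d A N₁ N₂ N₃ L₁ L₂ L₃ H)
      (ENNReal.ofReal ((6 * A ^ 4 / a) ^ d * (2 * A *
          (8 * A ^ 3 / a * (2 ^ d * ((1 + A) * a) * (3 * a) ^ (d - 1))) * (2 * A)) *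
        (min L₁ L₃ * min H (N₁ / N₂ * max L₁ L₃) * (N₂ * √(N₂ * H) ^ (d - 1) / H))) ^
          (1 / 2 : ℝ)) := by
  have hA0 : 0 < A := by linarith
  have ha0 : 0 < a := by rw [ha]; positivity
  have ha1 : a ≤ 1 := by
    rw [ha, div_le_one (by positivity)]
    have : 1 ≤ A ^ 9 := one_le_pow₀ hA
    linarith
  set ρ := √(N₂ * H) with hρdef
  have hρ : 0 < ρ := Real.sqrt_pos.2 (mul_pos hN₂ hH)
  have hρ2 : ρ ^ 2 = N₂ * H := Real.sq_sqrt (by positivity)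
  have hsw : Measurable fun q : FreqSpace d × FreqSpace d × FreqSpace d =>
      (q.2.1, q.1, q.2.2) := by fun_prop
  refine TriBound.swap₁₂ measurableSet_blockSet ?_
  have key := triBound_of_cyl_localized_fiber
    (E := {q : FreqSpace d × FreqSpace d × FreqSpace d |
      (q.2.1, q.1, q.2.2) ∈ blockSet d A N₁ N₂ N₃ L₁ L₂ L₃ H})
    (hsw measurableSet_blockSet) (r := a * N₂) (s := a * ρ) (k := 6 * A ^ 4 / a)
    (by positivity) (by positivity) (by positivity)
    (M := ENNReal.ofReal (2 * A * (8 * A ^ 3 / a * (2 ^ d * ((1 + A) * a) * (3 * a) ^ (d - 1))) *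
      (2 * A) * (min L₁ L₃ * min H (N₁ / N₂ * max L₁ L₃) * (N₂ * ρ ^ (d - 1) / H)))) ?_ ?_ ?_
  · convert key using 2
    rw [← ENNReal.ofReal_mul (by positivity)]
    congr 1; ring
  · rintro ⟨z₂, z₁, z₃⟩ ⟨-, -, ⟨h2, -, -⟩, -, ⟨h3, -, -⟩⟩
    simp only at h2 h3 ⊢
    have h2 := h2.2
    have h3 := h3.2
    refine ⟨?_, ?_⟩ <;> intro h <;> simp [h] at h2 h3 <;> linarith
  · rintro ⟨z₂, z₁, z₃⟩ ⟨h0, h1, ⟨h2, -, -⟩, ⟨h4, -, -⟩, ⟨h3, -, -⟩⟩ y ⟨hy1, hy2⟩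
    have h1 := resonance_mem h0 h1
    simp only at h0 h1 h2 h3 h4 hy1 hy2 ⊢
    have hsp : z₁.1 + z₂.1 + z₃.1 = 0 := congrArg Prod.fst h0
    have e3 : -z₃.1 = z₁.1 + z₂.1 := (eq_neg_of_add_eq_zero_left hsp).symm
    have e4 : ‖z₃.1‖ = ‖z₁.1 + z₂.1‖ := by rw [← e3, norm_neg]
    rw [e4] at h1 h3
    have e5 : y + z₃.1 = (y - z₁.1) - z₂.1 := by
      rw [← neg_neg z₃.1, e3]; abel
    rw [e3, e5]
    have hκ : 6 * A ^ 4 / a * (a * N₂) = 6 * A ^ 4 * N₂ := by field_simp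
    have hκ' : 6 * A ^ 4 / a * (a * ρ) = 6 * A ^ 4 * ρ := by field_simp
    have hA4 : A ≤ A ^ 4 := le_self_pow₀ hA (by norm_num)
    have hA34 : A ^ 3 ≤ A ^ 4 := pow_le_pow_right₀ hA (by norm_num)
    have hA14 : 1 ≤ A ^ 4 := one_le_pow₀ hA
    refine ⟨?_, ?_⟩
    · rw [hκ]
      calc ‖y - z₁.1 - z₂.1‖ ≤ a * N₂ + A * N₂ :=
            (norm_sub_le _ _).trans (add_le_add hy1 h4.1)
        _ ≤ A ^ 4 * N₂ + A ^ 4 * N₂ := by gcongr; linarith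
        _ ≤ _ := by nlinarith [mul_pos (pow_pos hA0 4) hN₂]
    · rw [hκ', perp_sub]
      have hch := norm_perp_change z₁.1 (z₁.1 + z₂.1) (y - z₁.1)
      have hup := norm_dir_sub_dir_add_le hA hN₁ hN₂ hH hρ hρ2 h13 h4 h2 h3 h1
      have hpp := norm_perp_add_le hA hN₁ hN₂ hH hρ hρ2 h13 h4 h2 h3 h1
      have h7 : ‖y - z₁.1‖ * ‖dir z₁.1 - dir (z₁.1 + z₂.1)‖ ≤ 2 * A ^ 4 * ρ := by
        calc ‖y - z₁.1‖ * ‖dir z₁.1 - dir (z₁.1 + z₂.1)‖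
            ≤ (1 * (A * N₁)) * ‖dir z₁.1 - dir (z₁.1 + z₂.1)‖ := by
              gcongr
              exact hy1.trans (by gcongr)
          _ = A * (‖dir z₁.1 - dir (z₁.1 + z₂.1)‖ * N₁) := by ring
          _ ≤ A * (2 * A ^ 3 * ρ) := by gcongr
          _ = _ := by ring
      calc _ ≤ (a * ρ + 2 * A ^ 4 * ρ) + 2 * A ^ 3 * ρ :=
            (norm_sub_le _ _).trans (add_le_add (hch.trans (add_le_add hy2 h7)) hpp)
        _ ≤ (A ^ 4 * ρ + 2 * A ^ 4 * ρ) + 2 * A ^ 4 * ρ := by gcongr; linarith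
        _ ≤ _ := by nlinarith [mul_pos (pow_pos hA0 4) hρ]
  · intro x y
    have hF : MeasurableSet {w : FreqSpace d |
        (x, w, -x - w) ∈ {q : FreqSpace d × FreqSpace d × FreqSpace d |
          (q.2.1, q.1, q.2.2) ∈ blockSet d A N₁ N₂ N₃ L₁ L₂ L₃ H} ∧
        y - w.1 ∈ cyl w.1 (a * N₂) (a * ρ)} := by
      refine measurableSet_and ?_ ?_
      · exact hsw.comp (measurable_triple_left x) measurableSet_blockSet
      · simp only [cyl, perp, Set.mem_ofPred_eq]
        refine measurableSet_and ?_ ?_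
        · apply measurableSet_le <;> fun_prop
        · apply measurableSet_le <;> fun_prop
    rcases Set.eq_empty_or_nonempty {w : FreqSpace d |
        (x, w, -x - w) ∈ {q : FreqSpace d × FreqSpace d × FreqSpace d |
          (q.2.1, q.1, q.2.2) ∈ blockSet d A N₁ N₂ N₃ L₁ L₂ L₃ H} ∧
        y - w.1 ∈ cyl w.1 (a * N₂) (a * ρ)} with he | ⟨w₀, ⟨hw₀, -⟩⟩
    · rw [he, measure_empty]; exact zero_le
    obtain ⟨-, -, -, ⟨hx1, hx2, -⟩, -⟩ := hw₀
    have hS := volume_second_fixed_le (τ := x.2) (m := 2 * A * max L₁ L₃) (y := y) hA hN₁ hN₂ hH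
      hρ hρ2 (by positivity) hx2 h13 h31 h21 hH2 ha hx1
    rw [show N₁ * (2 * A * max L₁ L₃) / N₂ = 2 * A * (N₁ / N₂ * max L₁ L₃) by ring] at hS
    refine le_trans (volume_le_of_mem_slab hF _
      (c₁ := fun ξ => ‖ξ‖) (c₂ := fun ξ => ‖ξ + x.1‖ - x.2) (m₁ := A * L₁) (m₂ := A * L₃) ?_)
      (fiber_bound hA (by positivity) hL₁.le hL₃.le (by positivity) (by linarith) hH hS)
    rintro w ⟨⟨h0, h1, ⟨h2, h3, h4⟩, -, ⟨h5, h6, h7⟩⟩, hy⟩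
    have h1 := resonance_mem h0 h1
    have e1 : ‖(-x - w).1‖ = ‖w.1 + x.1‖ := by
      rw [show (-x - w).1 = -(w.1 + x.1) by simp [sub_eq_add_neg, add_comm], norm_neg]
    have e2 : (-x - w).2 = -x.2 - w.2 := by simp
    simp only [e1, e2] at h1 h2 h3 h4 h5 h6 h7
    have k1 := abs_le.1 h4.1
    have k2 := abs_le.1 h7.1
    have k3 := add_le_two_mul_max hA0.le L₁ L₃
    exact ⟨⟨h2, h5, h1, abs_le.2 ⟨by linarith, by linarith⟩, hy⟩, h4.1,
      abs_le.2 ⟨by linarith, by linarith⟩⟩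

/-- Estimate by the size of the set of possible third frequencies. -/
theorem triBound_volume_third [NeZero d] (hA : 1 ≤ A) (hN₃ : 0 < N₃) (hL₃ : 0 < L₃) :
    TriBound (blockSet d A N₁ N₂ N₃ L₁ L₂ L₃ H)
      (ENNReal.ofReal (2 * A * (2 * A) ^ d * (L₃ * N₃ ^ d)) ^ (1 / 2 : ℝ)) := by
  have hA0 : 0 < A := by linarith
  have hsw : Measurable fun q : FreqSpace d × FreqSpace d × FreqSpace d =>
      (q.1, q.2.2, q.2.1) := by fun_prop
  refine TriBound.swap₂₃ (triBound_of_fiber (hsw measurableSet_blockSet) fun x => ?_)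
  refine (volume_le_of_mem_slab (hsw.comp (measurable_triple_left x) measurableSet_blockSet)
    (Metric.closedBall 0 (A * N₃)) (c₁ := fun ξ => -‖ξ‖) (c₂ := fun ξ => -‖ξ‖) (m₁ := A * L₃)
    (m₂ := A * L₃) ?_).trans ?_
  · rintro w ⟨-, -, -, -, ⟨h5, -, h7⟩⟩
    rw [sub_neg_eq_add, mem_closedBall_zero_iff]
    exact ⟨h5.1, h7.1, h7.1⟩
  · refine (mul_le_mul_right (volume_closedBall_le _ (by positivity)) _).trans ?_
    rw [← ENNReal.ofReal_mul (by positivity), min_self]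
    apply ENNReal.ofReal_le_ofReal
    apply le_of_eq
    rw [mul_pow, mul_pow]; ring

/-- Estimate for high-high interactions with the third frequency fixed; the second one is localised
to a ball of radius `N₃`. -/
theorem triBound_high_high [NeZero d] (hA : 1 ≤ A) (hN₃ : 0 < N₃) (hL₁ : 0 < L₁) (hL₂ : 0 < L₂)
    (hK : 8 * A ^ 2 * N₃ ≤ N₂) :
    TriBound (blockSet d A N₁ N₂ N₃ L₁ L₂ L₃ H)
      (ENNReal.ofReal ((1 + A) ^ d * (2 * A * (4 ^ d * 4) * (2 * A)) *
        (min L₁ L₂ * min N₃ (max L₁ L₂) * (N₃ ^ d / N₃))) ^ (1 / 2 : ℝ)) := by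
  have hA0 : 0 < A := by linarith
  have hsw : Measurable fun q : FreqSpace d × FreqSpace d × FreqSpace d =>
      (q.2.2, q.2.1, q.1) := by fun_prop
  have large : ∀ ξ : EuclideanSpace ℝ (Fin d), SimBy A ‖ξ‖ N₂ → 8 * A * N₃ ≤ ‖ξ‖ := by
    intro ξ hξ
    have : A * (8 * A * N₃) ≤ A * ‖ξ‖ := by
      calc A * (8 * A * N₃) = 8 * A ^ 2 * N₃ := by ring
        _ ≤ A * ‖ξ‖ := hK.trans hξ.2
    exact le_of_mul_le_mul_left this hA0
  refine TriBound.swap₁₃ measurableSet_blockSet ?_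
  have key := triBound_of_cyl_localized_fiber
    (E := {q : FreqSpace d × FreqSpace d × FreqSpace d |
      (q.2.2, q.2.1, q.1) ∈ blockSet d A N₁ N₂ N₃ L₁ L₂ L₃ H})
    (hsw measurableSet_blockSet) (r := N₃) (s := N₃) (k := 1 + A) hN₃ hN₃ (by positivity)
    (M := ENNReal.ofReal (2 * A * (4 ^ d * 4) * (2 * A) *
      (min L₁ L₂ * min N₃ (max L₁ L₂) * (N₃ ^ d / N₃)))) ?_ ?_ ?_
  · convert key using 2
    rw [← ENNReal.ofReal_mul (by positivity)]
    congr 1; ring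
  · rintro ⟨z₃, z₂, z₁⟩ ⟨h0, -, -, ⟨h2, -, -⟩, ⟨h3, -, -⟩⟩
    simp only at h0 h2 h3 ⊢
    have h4 := large _ h2
    have hpos : 0 < A * N₃ := mul_pos hA0 hN₃
    have h3 := h3.1
    have hsp : z₁.1 + z₂.1 + z₃.1 = 0 := congrArg Prod.fst h0
    refine ⟨?_, ?_⟩ <;> intro h
    · rw [h, norm_zero] at h4; linarith
    · rw [h, zero_add] at hsp
      rw [eq_neg_of_add_eq_zero_left hsp, norm_neg] at h4
      linarith
  · rintro ⟨z₃, z₂, z₁⟩ ⟨h0, -, -, -, ⟨h3, -, -⟩⟩ y ⟨hy1, -⟩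
    simp only at h0 h3 hy1 ⊢
    have hsp : z₁.1 + z₂.1 + z₃.1 = 0 := congrArg Prod.fst h0
    have e : y + z₁.1 = (y - z₂.1) - z₃.1 := by
      have : z₁.1 = -z₂.1 - z₃.1 := by
        rw [← sub_eq_zero, ← hsp]; abel
      rw [this]; abel
    have hn : ‖y + z₁.1‖ ≤ (1 + A) * N₃ := by
      rw [e]
      calc _ ≤ N₃ + A * N₃ := (norm_sub_le _ _).trans (add_le_add hy1 h3.1)
        _ = _ := by ring
    exact ⟨hn, (norm_perp_le _ _).trans hn⟩
  · intro x y
    have hF : MeasurableSet {w : FreqSpace d |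
        (x, w, -x - w) ∈ {q : FreqSpace d × FreqSpace d × FreqSpace d |
          (q.2.2, q.2.1, q.1) ∈ blockSet d A N₁ N₂ N₃ L₁ L₂ L₃ H} ∧
        y - w.1 ∈ cyl w.1 N₃ N₃} := by
      refine measurableSet_and ?_ ?_
      · exact hsw.comp (measurable_triple_left x) measurableSet_blockSet
      · simp only [cyl, perp, Set.mem_ofPred_eq]
        refine measurableSet_and ?_ ?_
        · apply measurableSet_le <;> fun_prop
        · apply measurableSet_le <;> fun_prop
    rcases Set.eq_empty_or_nonempty {w : FreqSpace d |
        (x, w, -x - w) ∈ {q : FreqSpace d × FreqSpace d × FreqSpace d |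
          (q.2.2, q.2.1, q.1) ∈ blockSet d A N₁ N₂ N₃ L₁ L₂ L₃ H} ∧
        y - w.1 ∈ cyl w.1 N₃ N₃} with he | ⟨w₀, ⟨hw₀, -⟩⟩
    · rw [he, measure_empty]; exact zero_le
    obtain ⟨-, -, -, -, ⟨hx1, -, -⟩⟩ := hw₀
    have hS := volume_sum_slab_le (τ := x.2) (m := 2 * A * max L₁ L₂) (y := y) hA hN₃
      (by positivity) (ζ := x.1) hx1.1
    rw [min_comm L₁ L₂]
    refine le_trans (volume_le_of_mem_slab hF _
      (c₁ := fun ξ => ‖ξ‖) (c₂ := fun ξ => -‖ξ + x.1‖ - x.2) (m₁ := A * L₂) (m₂ := A * L₁) ?_)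
      (fiber_bound hA (by positivity) hL₂.le hL₁.le (by positivity) (by linarith) hN₃ hS)
    rintro w ⟨⟨-, -, ⟨h5, h6, h7⟩, ⟨h2, h3, h4⟩, -⟩, hy⟩
    have e1 : ‖(-x - w).1‖ = ‖w.1 + x.1‖ := by
      rw [show (-x - w).1 = -(w.1 + x.1) by simp [sub_eq_add_neg, add_comm], norm_neg]
    have e2 : (-x - w).2 = -x.2 - w.2 := by simp
    simp only [e1, e2] at h2 h3 h4 h5 h6 h7
    have k1 := abs_le.1 h4.1
    have k2 := abs_le.1 h7.1
    have k3 := add_le_two_mul_max hA0.le L₁ L₂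
    exact ⟨⟨hy.1, large _ h2, abs_le.2 ⟨by linarith, by linarith⟩⟩, h4.1,
      abs_le.2 ⟨by linarith, by linarith⟩⟩

end Cases

/-! ### Choice of the fixed frequency -/

section Conclusion
variable {d : ℕ}

theorem tripleMin_eq (L : Fin 3 → ℝ) {i j : Fin 3} (h : (i = 0 ∧ j = 1) ∨ (i = 1 ∧ j = 0)) :
    tripleMin L = min (L i) (min (L j) (L 2)) := by
  rcases h with ⟨rfl, rfl⟩ | ⟨rfl, rfl⟩
  · rfl
  · exact min_left_comm _ _ _

theorem tripleMax_eq (L : Fin 3 → ℝ) {i j : Fin 3} (h : (i = 0 ∧ j = 1) ∨ (i = 1 ∧ j = 0)) :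
    tripleMax L = max (L i) (max (L j) (L 2)) := by
  rcases h with ⟨rfl, rfl⟩ | ⟨rfl, rfl⟩
  · rfl
  · exact max_left_comm _ _ _

theorem tripleMed_eq (L : Fin 3 → ℝ) {i j : Fin 3} (h : (i = 0 ∧ j = 1) ∨ (i = 1 ∧ j = 0)) :
    tripleMed L = max (min (L i) (L j)) (max (min (L j) (L 2)) (min (L 2) (L i))) := by
  rcases h with ⟨rfl, rfl⟩ | ⟨rfl, rfl⟩
  · rfl
  · rw [tripleMed, min_comm (L 0), max_comm (min (L 1) (L 2)), min_comm (L 2) (L 0),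
      min_comm (L 1) (L 2)]

/-- The block norm in terms of `TriBound`; the first two frequencies may be interchanged. -/
theorem waveBlockNorm_le {A H : ℝ} {N L : Fin 3 → ℝ} {i j : Fin 3}
    (h : (i = 0 ∧ j = 1) ∨ (i = 1 ∧ j = 0)) {c : ℝ≥0∞}
    (hT : TriBound (blockSet d A (N i) (N j) (N 2) (L i) (L j) (L 2) H) c) :
    waveBlockNorm d A N L H ≤ c := by
  have hT' : TriBound (blockSet d A (N 0) (N 1) (N 2) (L 0) (L 1) (L 2) H) c := by
    rcases h with ⟨rfl, rfl⟩ | ⟨rfl, rfl⟩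
    · exact hT
    · exact TriBound.swap₁₂ measurableSet_blockSet (hT.mono_set fun q hq => mem_blockSet_swap hq)
  refine multiplierNorm3_le_of_triBound measurableSet_blockSet hT' fun p => ?_
  unfold waveBlock
  split_ifs with hc
  · rw [Set.indicator_of_mem]
    · simp
    · obtain ⟨h1, h2⟩ := hc
      have a0 := h2 0
      have a1 := h2 1
      have a2 := h2 2
      simp only [waveResonance, Fin.sum_univ_three, gammaPoint, waveModulation, Matrix.cons_val,
        one_mul, neg_mul, ← sub_eq_add_neg, sub_neg_eq_add, Left.nonneg_neg_iff] at h1 a0 a1 a2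
      exact ⟨by simp, h1, a0, a1, a2⟩
  · simp

/-- A block of nonzero norm is nonempty. -/
theorem exists_mem_blockSet {A H : ℝ} {N L : Fin 3 → ℝ} {i j : Fin 3}
    (h : (i = 0 ∧ j = 1) ∨ (i = 1 ∧ j = 0)) (h0 : waveBlockNorm d A N L H ≠ 0) :
    ∃ q, q ∈ blockSet d A (N i) (N j) (N 2) (L i) (L j) (L 2) H := by
  by_contra hne
  push Not at hne
  exact h0 (le_antisymm (waveBlockNorm_le h (triBound_of_forall_notMem hne 0)) zero_le)

/-- The third frequency is estimated by volume when its modulation is the smallest one; otherwise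
that modulation exceeds `N₃` and the third frequency is fixed. -/
theorem high_high_bound [NeZero d] {A : ℝ} (hA : 1 ≤ A) :
    ∃ C : ℝ, 0 < C ∧ ∀ N₁ N₂ N₃ L₁ L₂ L₃ H : ℝ, 0 < N₃ → 0 < L₁ → 0 < L₂ → 0 < L₃ →
      8 * A ^ 2 * N₃ ≤ N₂ →
      TriBound (blockSet d A N₁ N₂ N₃ L₁ L₂ L₃ H) (ENNReal.ofReal
        (C * min L₁ (min L₂ L₃) ^ (1 / 2 : ℝ) *
          min (max (min L₁ L₂) (max (min L₂ L₃) (min L₃ L₁))) N₃ ^ (1 / 2 : ℝ) *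
          N₃ ^ (((d : ℝ) - 1) / 2))) := by
  have hA0 : 0 < A := by linarith
  set cA := 2 * A * (2 * A) ^ d with hcA
  set cB := (1 + A) ^ d * (2 * A * (4 ^ d * 4) * (2 * A)) with hcB
  have hA' : 0 < cA := by positivity
  have hB' : 0 < cB := by positivity
  refine ⟨1 + (cA + cB), by positivity, fun N₁ N₂ N₃ L₁ L₂ L₃ H hN₃ hL₁ hL₂ hL₃ hK => ?_⟩
  by_cases hne : ∃ q, q ∈ blockSet d A N₁ N₂ N₃ L₁ L₂ L₃ H
  swap
  · push Not at hne
    exact triBound_of_forall_notMem hne _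
  obtain ⟨q, hq⟩ := hne
  have hK0 : 0 < 8 * A ^ 2 := by positivity
  set l := min L₁ (min L₂ L₃) with hl
  set m := max (min L₁ L₂) (max (min L₂ L₃) (min L₃ L₁)) with hm
  have hl0 : 0 < l := lt_min hL₁ (lt_min hL₂ hL₃)
  have hm0 : 0 < m := (lt_min hL₁ hL₂).trans_le (le_max_left _ _)
  have hfin := ofReal_rpow_half_le (c := cA + cB) (l := l) (m := min m N₃) (X := 1)
    (Y := N₃ ^ (((d : ℝ) - 1) / 2)) (by positivity) hl0.le (le_min hm0.le hN₃.le) zero_le_one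
    (by positivity)
  rw [mul_one] at hfin
  have hY : (1 * N₃ ^ (((d : ℝ) - 1) / 2)) ^ 2 = N₃ ^ d / N₃ := by
    rw [one_mul, ← Real.rpow_natCast, ← Real.rpow_mul hN₃.le, ← Real.rpow_natCast N₃ d,
      ← Real.rpow_sub_one hN₃.ne']
    congr 1
    push_cast
    ring
  rw [hY] at hfin
  -- either the third modulation is minimal and the first two exceed `N₃`, or it exceeds `N₃`
  -- and is not minimal
  have hcases : (L₃ ≤ L₁ ∧ L₃ ≤ L₂ ∧ N₃ ≤ L₁ ∧ N₃ ≤ L₂) ∨ (N₃ ≤ L₃ ∧ min L₁ L₂ ≤ L₃) := by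
    rcases le_total (8 * A ^ 2 * L₃) N₂ with h | h
    · obtain ⟨h1, h2⟩ := (blockSet_high_high hA hK hq).2 h
      exact Or.inl ⟨le_of_mul_le_mul_left (h.trans h1.2) hK0,
        le_of_mul_le_mul_left (h.trans h2.2) hK0, le_of_mul_le_mul_left (hK.trans h1.2) hK0,
        le_of_mul_le_mul_left (hK.trans h2.2) hK0⟩
    · have h3 : N₃ ≤ L₃ := le_of_mul_le_mul_left (hK.trans h) hK0
      rcases le_total (min L₁ L₂) L₃ with h4 | h4
      · exact Or.inr ⟨h3, h4⟩
      · obtain ⟨h5, h6⟩ := le_min_iff.1 h4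
        exact Or.inl ⟨h5, h6, h3.trans h5, h3.trans h6⟩
  rcases hcases with ⟨h1, h2, h3, h4⟩ | ⟨h1, h2⟩
  · refine (triBound_volume_third hA hN₃ hL₃).mono (le_trans ?_ hfin)
    gcongr ENNReal.ofReal ?_ ^ _
    have e1 : l = L₃ := by rw [hl, min_eq_right h2, min_eq_right h1]
    have e2 : min m N₃ = N₃ := min_eq_right ((le_min h3 h4).trans (le_max_left _ _))
    rw [e1, e2, mul_assoc L₃, mul_div_cancel₀ _ hN₃.ne']
    gcongr
    linarith
  · refine (triBound_high_high hA hN₃ hL₁ hL₂ hK).mono (le_trans ?_ hfin)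
    gcongr ENNReal.ofReal ?_ ^ _
    have e1 : l = min L₁ L₂ := by rw [hl, ← min_assoc, min_eq_left h2]
    have e2 : min N₃ (max L₁ L₂) ≤ min m N₃ := by
      refine le_min ?_ (min_le_left _ _)
      rcases le_total L₁ L₂ with h | h
      · rw [max_eq_right h]
        exact (le_min (min_le_right _ _) ((min_le_left _ _).trans h1)).trans
          ((le_max_left _ _).trans (le_max_right _ _))
      · rw [max_eq_left h]
        exact (le_min ((min_le_left _ _).trans h1) (min_le_right _ _)).trans
          ((le_max_right _ _).trans (le_max_right _ _))
    rw [e1]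
    have : cB ≤ cA + cB := by linarith
    gcongr

/-- The frequency of maximal modulation is fixed; it is the first or the third. -/
theorem high_low_bound [NeZero d] {A : ℝ} (hA : 1 ≤ A) :
    ∃ C : ℝ, 0 < C ∧ ∀ N₁ N₂ N₃ L₁ L₂ L₃ H : ℝ, 0 < N₁ → 0 < N₂ → 0 < L₁ → 0 < L₂ →
      0 < L₃ → 0 < H → N₁ ≤ A * N₃ → N₃ ≤ A * N₁ → N₂ ≤ A * N₁ → H ≤ A * N₂ →
      L₂ ≤ max L₁ L₃ →
      TriBound (blockSet d A N₁ N₂ N₃ L₁ L₂ L₃ H) (ENNReal.ofReal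
        (C * (H / N₂) ^ (((d : ℝ) - 3) / 4) * min L₁ (min L₂ L₃) ^ (1 / 2 : ℝ) *
          min H (max (min L₁ L₂) (max (min L₂ L₃) (min L₃ L₁))) ^ (1 / 2 : ℝ) *
          N₂ ^ (((d : ℝ) - 1) / 2))) := by
  have hA0 : 0 < A := by linarith
  set c := 2 * A * (2 ^ d * 16 * A ^ 6 * (2 ^ d * A * (2 * A ^ 3) ^ (d - 1))) * (2 * A) with hc
  have hc0 : 0 < c := by positivity
  refine ⟨1 + c, by positivity, fun N₁ N₂ N₃ L₁ L₂ L₃ H hN₁ hN₂ hL₁ hL₂ hL₃ hH h13 h31 h21 hH2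
    hL => ?_⟩
  set l := min L₁ (min L₂ L₃) with hl
  set m := max (min L₁ L₂) (max (min L₂ L₃) (min L₃ L₁)) with hm
  have hl0 : 0 < l := lt_min hL₁ (lt_min hL₂ hL₃)
  have hm0 : 0 < m := (lt_min hL₁ hL₂).trans_le (le_max_left _ _)
  have hfin := ofReal_rpow_half_le (c := c) (l := l) (m := min H m)
    (X := (H / N₂) ^ (((d : ℝ) - 3) / 4)) (Y := N₂ ^ (((d : ℝ) - 1) / 2))
    hc0.le hl0.le (le_min hH.le hm0.le) (by positivity) (by positivity)
  rw [← mul_sqrt_pow_div_eq (Nat.one_le_iff_ne_zero.2 (NeZero.ne d)) hN₂ hH] at hfin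
  rcases le_total L₃ L₁ with h | h
  · rw [max_eq_left h] at hL
    refine (triBound_first_fixed hA hN₁ hN₂ hL₂ hL₃ hH h31 h21 hH2).mono (le_trans ?_ hfin)
    have e1 : l = min L₂ L₃ := by
      rw [hl, min_eq_right ((min_le_left _ _).trans hL)]
    have e2 : m = max L₂ L₃ := by
      rw [hm, min_eq_right hL, min_eq_left h, max_eq_right (min_le_right L₂ L₃)]
    rw [e1, e2]
  · rw [max_eq_right h] at hL
    refine (triBound_third_fixed hA hN₁ hN₂ hL₁ hL₂ hH h13).mono (le_trans ?_ hfin)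
    have e1 : l = min L₁ L₂ := by rw [hl, min_eq_left hL]
    have e2 : m = max L₁ L₂ := by
      rw [hm, min_eq_left hL, min_eq_right h,
        max_eq_right ((min_le_right L₁ L₂).trans (le_max_left L₂ L₁)), max_comm]
    rw [e1, e2]

/-- The second frequency, whose modulation is comparable to the maximal one, is fixed. -/
theorem plus_minus_high_high_bound [NeZero d] {A : ℝ} (hA : 1 ≤ A) :
    ∃ C : ℝ, 0 < C ∧ ∀ N₁ N₂ N₃ L₁ L₂ L₃ H : ℝ, 0 < N₁ → 0 < N₂ → 0 < N₃ → 0 < L₁ → 0 < L₂ →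
      0 < L₃ → 0 < H → N₁ ≤ A * N₃ → N₃ ≤ A * N₁ → N₂ ≤ A * N₁ → H ≤ A * N₂ →
      L₁ ≤ A * L₂ → L₃ ≤ A * L₂ →
      TriBound (blockSet d A N₁ N₂ N₃ L₁ L₂ L₃ H) (ENNReal.ofReal
        (C * (H / N₂) ^ (((d : ℝ) - 3) / 4) * min L₁ (min L₂ L₃) ^ (1 / 2 : ℝ) *
          min H (N₁ / N₂ * max (min L₁ L₂) (max (min L₂ L₃) (min L₃ L₁))) ^ (1 / 2 : ℝ) *
          N₂ ^ (((d : ℝ) - 1) / 2))) := by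
  have hA0 : 0 < A := by linarith
  obtain ⟨a, ha⟩ : ∃ a, a = 1 / (128 * A ^ 9) := ⟨_, rfl⟩
  have ha0 : 0 < a := by rw [ha]; positivity
  set c := (6 * A ^ 4 / a) ^ d * (2 * A *
    (8 * A ^ 3 / a * (2 ^ d * ((1 + A) * a) * (3 * a) ^ (d - 1))) * (2 * A)) with hc
  have hc0 : 0 < c := by positivity
  refine ⟨1 + c * A ^ 2, by positivity, fun N₁ N₂ N₃ L₁ L₂ L₃ H hN₁ hN₂ hN₃ hL₁ hL₂ hL₃ hH h13
    h31 h21 hH2 h1 h3 => ?_⟩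
  set l := min L₁ (min L₂ L₃) with hl
  set m := max (min L₁ L₂) (max (min L₂ L₃) (min L₃ L₁)) with hm
  have hl0 : 0 < l := lt_min hL₁ (lt_min hL₂ hL₃)
  have hm0 : 0 < m := (lt_min hL₁ hL₂).trans_le (le_max_left _ _)
  have hfin := ofReal_rpow_half_le (c := c * A ^ 2) (l := l) (m := min H (N₁ / N₂ * m))
    (X := (H / N₂) ^ (((d : ℝ) - 3) / 4)) (Y := N₂ ^ (((d : ℝ) - 1) / 2))
    (by positivity) hl0.le (le_min hH.le (by positivity)) (by positivity) (by positivity)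
  rw [← mul_sqrt_pow_div_eq (Nat.one_le_iff_ne_zero.2 (NeZero.ne d)) hN₂ hH] at hfin
  refine (triBound_second_fixed hA hN₁ hN₂ hN₃ hL₁ hL₃ hH h13 h31 h21 hH2 ha).mono
    (le_trans ?_ hfin)
  gcongr ENNReal.ofReal ?_ ^ _
  have grow : ∀ x : ℝ, 0 ≤ x → x ≤ A * x := fun x hx => le_mul_of_one_le_left hx hA
  have e1 : min L₁ L₃ ≤ A * l := by
    rw [hl, mul_min_of_nonneg _ _ hA0.le, mul_min_of_nonneg _ _ hA0.le]
    exact le_min ((min_le_left _ _).trans (grow _ hL₁.le))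
      (le_min ((min_le_left _ _).trans h1) ((min_le_right _ _).trans (grow _ hL₃.le)))
  have e2 : max L₁ L₃ ≤ A * m := by
    refine max_le ?_ ?_
    · calc L₁ ≤ A * min L₁ L₂ := by
            rw [mul_min_of_nonneg _ _ hA0.le]; exact le_min (grow _ hL₁.le) h1
        _ ≤ A * m := by gcongr; exact le_max_left _ _
    · calc L₃ ≤ A * min L₂ L₃ := by
            rw [mul_min_of_nonneg _ _ hA0.le]; exact le_min h3 (grow _ hL₃.le)
        _ ≤ A * m := by gcongr; exact (le_max_left _ _).trans (le_max_right _ _)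
  have e3 : min H (N₁ / N₂ * max L₁ L₃) ≤ A * min H (N₁ / N₂ * m) := by
    rw [mul_min_of_nonneg _ _ hA0.le]
    refine min_le_min (grow _ hH.le) ?_
    calc N₁ / N₂ * max L₁ L₃ ≤ N₁ / N₂ * (A * m) := by gcongr
      _ = _ := by ring
  have hmin : 0 ≤ min H (N₁ / N₂ * max L₁ L₃) := le_min hH.le (by positivity)
  calc c * (min L₁ L₃ * min H (N₁ / N₂ * max L₁ L₃) * (N₂ * √(N₂ * H) ^ (d - 1) / H))
      ≤ c * ((A * l) * (A * min H (N₁ / N₂ * m)) * (N₂ * √(N₂ * H) ^ (d - 1) / H)) := by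
        gcongr
    _ = _ := by ring

end Conclusion

theorem mainTheorem4 (d : ℕ) (hd : 2 ≤ d) (A : ℝ) (hA : 1 ≤ A) :
    ∃ K : ℝ, 1 < K ∧ ∀ B : ℝ, 1 ≤ B → ∃ C : ℝ, 0 < C ∧
      ∀ (N L : Fin 3 → ℝ) (H : ℝ), (∀ j, 0 < N j) → (∀ j, 0 < L j) → 0 < H →
        SimBy B (tripleMax N) (tripleMed N) →
        SimBy B (tripleMax L) (max H (tripleMed L)) →
        H ≤ B * min (N 0) (N 1) →
        ∀ i j : Fin 3, (i = 0 ∧ j = 1) ∨ (i = 1 ∧ j = 0) →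
          -- (++) high-high interactions
          (SimBy B (N i) (N j) → K * N 2 ≤ N i →
            waveBlockNorm d A N L H ≤ ENNReal.ofReal
              (C * tripleMin L ^ (1 / 2 : ℝ) * min (tripleMed L) (N 2) ^ (1 / 2 : ℝ) *
                N 2 ^ (((d : ℝ) - 1) / 2)) ∧
            (waveBlockNorm d A N L H ≠ 0 → SimBy C H (N i)) ∧
            (K * L 2 ≤ N i → waveBlockNorm d A N L H ≠ 0 →
              SimBy C (L i) (N i) ∧ SimBy C (L j) (N i))) ∧
          -- high-low interactions
          (SimBy B (N i) (N 2) → N j ≤ B * N i → K * L j ≤ tripleMax L →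
            waveBlockNorm d A N L H ≤ ENNReal.ofReal
              (C * (H / N j) ^ (((d : ℝ) - 3) / 4) * tripleMin L ^ (1 / 2 : ℝ) *
                min H (tripleMed L) ^ (1 / 2 : ℝ) * N j ^ (((d : ℝ) - 1) / 2))) ∧
          -- (+-) high-high interactions
          (SimBy B (N i) (N 2) → N j ≤ B * N i → SimBy B (L j) (tripleMax L) →
            waveBlockNorm d A N L H ≤ ENNReal.ofReal
              (C * (H / N j) ^ (((d : ℝ) - 3) / 4) * tripleMin L ^ (1 / 2 : ℝ) *
                min H (N i / N j * tripleMed L) ^ (1 / 2 : ℝ) *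
                N j ^ (((d : ℝ) - 1) / 2))) := by
  have : NeZero d := ⟨by omega⟩
  have hA2 : 1 ≤ A ^ 2 := one_le_pow₀ hA
  refine ⟨8 * A ^ 2, by linarith, fun B hB => ?_⟩
  -- in the last two cases all constants are replaced by the larger of `A` and `B`
  set A' := max A B with hA'def
  have hA' : 1 ≤ A' := hA.trans (le_max_left _ _)
  obtain ⟨C₁, hC₁, h₁⟩ := high_high_bound (d := d) hA
  obtain ⟨C₂, hC₂, h₂⟩ := high_low_bound (d := d) hA'
  obtain ⟨C₃, hC₃, h₃⟩ := plus_minus_high_high_bound (d := d) hA'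
  refine ⟨8 * A ^ 2 + C₁ + C₂ + C₃, by positivity, ?_⟩
  intro N L H hN hL hH _ _ hHN i j hij
  have hji : (j = 0 ∧ i = 1) ∨ (j = 1 ∧ i = 0) := by tauto
  have hB' : ∀ x y : ℝ, 0 < y → x ≤ B * y → x ≤ A' * y := fun x y hy h =>
    h.trans (by gcongr; exact le_max_right _ _)
  have hHj : H ≤ A' * N j := by
    refine hB' _ _ (hN j) (hHN.trans ?_)
    gcongr
    rcases hij with ⟨-, rfl⟩ | ⟨-, rfl⟩
    · exact min_le_right _ _
    · exact min_le_left _ _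
  have hmono : ∀ q ∈ blockSet d A (N i) (N j) (N 2) (L i) (L j) (L 2) H,
      q ∈ blockSet d A' (N i) (N j) (N 2) (L i) (L j) (L 2) H := fun q hq =>
    mem_blockSet_mono (le_max_left _ _) (hN _).le (hN _).le (hN _).le (hL _).le (hL _).le
      (hL _).le hH.le hq
  have hmin : 0 < tripleMin L := lt_min (hL 0) (lt_min (hL 1) (hL 2))
  have hmed : 0 < tripleMed L := (lt_min (hL 0) (hL 1)).trans_le (le_max_left _ _)
  have hNi := hN i
  have hNj := hN j
  have hN2 := hN 2
  have hmn : 0 ≤ min (tripleMed L) (N 2) := le_min hmed.le hN2.le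
  have hmH : 0 ≤ min H (tripleMed L) := le_min hH.le hmed.le
  have hmH' : 0 ≤ min H (N i / N j * tripleMed L) := le_min hH.le (by positivity)
  refine ⟨fun _ hK => ⟨?_, ?_, ?_⟩, fun h2 hNji hLj => ?_, fun h2 hNji hLj => ?_⟩
  · refine (waveBlockNorm_le hji (h₁ _ _ _ _ _ _ H hN2 (hL _) (hL _) (hL _) hK)).trans ?_
    rw [← tripleMin_eq L hji, ← tripleMed_eq L hji]
    apply ENNReal.ofReal_le_ofReal
    gcongr
    nlinarith
  · intro h0
    obtain ⟨q, hq⟩ := exists_mem_blockSet hji h0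
    exact (blockSet_high_high hA hK hq).1.mono (by linarith) hH.le hNi.le
  · intro hL2 h0
    obtain ⟨q, hq⟩ := exists_mem_blockSet hji h0
    obtain ⟨k1, k2⟩ := (blockSet_high_high hA hK hq).2 hL2
    exact ⟨k2.mono (by linarith) (hL _).le hNi.le, k1.mono (by linarith) (hL _).le hNi.le⟩
  · have hLj' : L j ≤ max (L i) (L 2) := by
      rw [tripleMax_eq L hij, max_left_comm] at hLj
      rcases le_max_iff.1 hLj with h | h
      · nlinarith [hL j]
      · nlinarith [hL j]
    refine (waveBlockNorm_le hij ((h₂ _ _ _ _ _ _ H hNi hNj (hL _) (hL _) (hL _) hH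
      (hB' _ _ hN2 h2.1) (hB' _ _ hNi h2.2) (hB' _ _ hNi hNji) hHj hLj').mono_set hmono)).trans ?_
    rw [← tripleMin_eq L hij, ← tripleMed_eq L hij]
    apply ENNReal.ofReal_le_ofReal
    gcongr
    nlinarith
  · have hLm := hLj.2
    rw [tripleMax_eq L hij] at hLm
    refine (waveBlockNorm_le hij ((h₃ _ _ _ _ _ _ H hNi hNj hN2 (hL _) (hL _) (hL _) hH
      (hB' _ _ hN2 h2.1) (hB' _ _ hNi h2.2) (hB' _ _ hNi hNji) hHj
      (hB' _ _ (hL j) ((le_max_left _ _).trans hLm))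
      (hB' _ _ (hL j) (((le_max_right _ _).trans (le_max_right _ _)).trans hLm))).mono_set
      hmono)).trans ?_
    rw [← tripleMin_eq L hij, ← tripleMed_eq L hij]
    apply ENNReal.ofReal_le_ofReal
    gcongr
    nlinarith
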